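/- A numerical semigroup is a subset $S$ of $\mathbb{N}=\{0,1,2,\dots\}$ that contains $0$, is closed under addition and has finite complement in $\mathbb{N}$. With $S^*=S\setminus\{0\}$, the primitives (minimal generators) of $S$ are the elements of $S^*\setminus(S^*+S^*)$. The Frobenius number of $S\neq\mathbb{N}$ is the largest positive integer not in $S$. For a positive integer $n$, let $A_n$ be the number of numerical semigroups whose maximum primitive is $n$, and let $N_n$ be the number of numerical semigroups whose Frobenius number is $n$. Then $$\lim_{n\to\infty}\frac{A_n}{N_n}=1.$$ Moreover, the subsequences $(A_{2n})$ and $(A_{2n+1})$ grow asymptotically as $c_0 2^{f/2}$ and $c_1 2^{f/2}$, where $f$ denotes the index ($f=2n$ and $f=2n+1$ respectively); that is, there exist real constants $c_0,c_1>0$ such that $$\lim_{n\to\infty}\frac{A_{2n}}{2^{n}}=c_0\qquad\text{and}\qquad \lim_{n\to\infty}\frac{A_{2n+1}}{2^{(2n+1)/2}}=c_1.$$ -/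

import Mathlib

open Filter Topology
open scoped Pointwise

/-- A numerical semigroup: a subset of `ℕ` containing `0`, closed under addition (that is, an
additive submonoid of `ℕ`), with finite complement. -/
def IsNumericalSemigroup (S : AddSubmonoid ℕ) : Prop :=
  ((S : Set ℕ)ᶜ).Finite

/-- The nonzero elements `S^* = S \ {0}`. -/
def nonzeroElements (S : AddSubmonoid ℕ) : Set ℕ :=
  (S : Set ℕ) \ {0}

/-- The primitives (minimal generators) `S^* \ (S^* + S^*)` of `S`. -/
def primitives (S : AddSubmonoid ℕ) : Set ℕ :=
  nonzeroElements S \ (nonzeroElements S + nonzeroElements S)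

/-- The gaps of `S`: the positive integers that do not belong to `S`. -/
def gaps (S : AddSubmonoid ℕ) : Set ℕ :=
  {k : ℕ | 0 < k ∧ k ∉ S}

/-- The set `𝒜_n` of numerical semigroups whose maximum primitive is `n`. -/
def maxPrimSet (n : ℕ) : Set (AddSubmonoid ℕ) :=
  {S | IsNumericalSemigroup S ∧ IsGreatest (primitives S) n}

/-- The set `𝒩_f` of numerical semigroups whose Frobenius number (largest gap) is `f`.
The semigroup `ℕ`, which has no gap, belongs to none of these sets. -/
def frobSet (f : ℕ) : Set (AddSubmonoid ℕ) :=
  {S | IsNumericalSemigroup S ∧ IsGreatest (gaps S) f}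

/-- `A_n`, the number of numerical semigroups with maximum primitive `n`. -/
noncomputable def maxPrimCard (n : ℕ) : ℕ := (maxPrimSet n).ncard

/-- `N_f`, the number of numerical semigroups with Frobenius number `f`. -/
noncomputable def frobCard (f : ℕ) : ℕ := (frobSet f).ncard

/-- The primitives generate `S`. -/
theorem closure_primitives (S : AddSubmonoid ℕ) : AddSubmonoid.closure (primitives S) = S := by
  apply le_antisymm
  · rw [AddSubmonoid.closure_le]
    exact fun x hx => hx.1.1
  · intro x hx
    induction x using Nat.strong_induction_on with
    | _ x ih =>
      by_cases h0 : x = 0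
      · rw [h0]; exact zero_mem _
      by_cases hp : x ∈ nonzeroElements S + nonzeroElements S
      · obtain ⟨a, ha, b, hb, rfl⟩ := hp
        have ha0 : a ≠ 0 := ha.2
        have hb0 : b ≠ 0 := hb.2
        exact add_mem (ih a (by simp only; omega) ha.1) (ih b (by simp only; omega) hb.1)
      · exact AddSubmonoid.subset_closure ⟨⟨hx, h0⟩, hp⟩

/-- The primitives form the least generating set of `S` under inclusion. -/
theorem isLeast_primitives (S : AddSubmonoid ℕ) :
    IsLeast {X : Set ℕ | AddSubmonoid.closure X = S} (primitives S) := by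
  refine ⟨closure_primitives S, ?_⟩
  rintro X hX p ⟨⟨hpS, hp0⟩, hp⟩
  have key : ∀ y ∈ AddSubmonoid.closure X,
      y = 0 ∨ y ∈ X ∨ y ∈ nonzeroElements S + nonzeroElements S := by
    intro y hy
    induction hy using AddSubmonoid.closure_induction with
    | mem x hx => exact Or.inr (Or.inl hx)
    | zero => exact Or.inl rfl
    | add x y hx hy ihx ihy =>
      by_cases hx0 : x = 0
      · simpa [hx0] using ihy
      by_cases hy0 : y = 0
      · simpa [hy0] using ihx
      · have hX' : AddSubmonoid.closure X = S := hX
        rw [hX'] at hx hy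
        exact Or.inr (Or.inr ⟨x, ⟨hx, hx0⟩, y, ⟨hy, hy0⟩, rfl⟩)
  have hX' : AddSubmonoid.closure X = S := hX
  rcases key p (hX' ▸ hpS) with h | h | h
  · exact absurd h hp0
  · exact h
  · exact absurd h hp

/-- `𝒜_n` is finite, so that `A_n` is its genuine cardinality. -/
theorem finite_maxPrimSet (n : ℕ) : (maxPrimSet n).Finite := by
  refine Set.Finite.of_finite_image (f := primitives)
    ((Set.finite_Iic n).finite_subsets.subset ?_) ?_
  · rintro _ ⟨S, hS, rfl⟩ x hx
    exact hS.2.2 hx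
  · intro S _ T _ h
    rw [← closure_primitives S, ← closure_primitives T, h]

/-- `𝒩_f` is finite, so that `N_f` is its genuine cardinality. -/
theorem finite_frobSet (f : ℕ) : (frobSet f).Finite := by
  refine Set.Finite.of_finite_image (f := gaps) ((Set.finite_Iic f).finite_subsets.subset ?_) ?_
  · rintro _ ⟨S, hS, rfl⟩ x hx
    exact hS.2.2 hx
  · intro S _ T _ h
    ext x
    rcases Nat.eq_zero_or_pos x with rfl | hx
    · simp
    · have := Set.ext_iff.mp h x
      simp only [gaps, Set.mem_ofPred_eq, hx, true_and] at this
      exact not_iff_not.mp this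

/-! Both counts are compared with the number t(n) of traces on [1, n) of submonoids avoiding n. A
semigroup with Frobenius number n contains everything beyond n, so N_n = t(n). One with maximum
primitive n is generated by n and its trace, so A_n ≤ t(n). Conversely a trace T arises from such a
semigroup unless T ∪ {n} has a common divisor d ≥ 2, and then T/d is a trace for n/d. Hence t(n) -
A_n is at most the sum of t(n/d) over divisors d ≥ 2 (`card_truncations_le_maxPrimCard_add`), which
is O(n 2^(n/4)), whereas t(n) is at least 2^(n/2)/2.

It remains to see that t(f)/2^(f/2) converges along each parity (`exists_tendsto_card_truncations`).
Traces whose elements all exceed f/2 - k, roughly, double in number exactly when f grows by 2, once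
f is large (`card_truncationsAbove_add_two`). Those with a smaller minimum m form a proportion
bounded by a summable function of f - 2m (`card_truncationsMin_le`), so the ratio is Cauchy.

For the latter bound, a trace with minimum m is encoded by its number of elements in each residue
class modulo m. Classes i and j with i + j ≡ f constrain each other: classes of l elements allow at
most (l² + 3l - 2)/2 ≤ 2^l pairs of counts. Multiplying over pairs gives √2^f, and an exponential
gain comes from strict inequality for l ≥ 4, or, for l = 3, from closure under addition, which links
different pairs. `traceCard_le_pow_mul_prod` does this bookkeeping. -/

/-! ### Truncations, and their relation to Frobenius numbers and maximum primitives. -/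

/-- The traces on `[1, f)` of the submonoids of `ℕ` that do not contain `f`. -/
def truncations (f : ℕ) : Finset (Finset ℕ) :=
  {T ∈ (Finset.Ico 1 f).powerset | ∀ x ∈ T, ∀ y ∈ T, x + y ≠ f ∧ (x + y < f → x + y ∈ T)}

theorem mem_truncations {f : ℕ} {T : Finset ℕ} :
    T ∈ truncations f ↔ (∀ x ∈ T, 1 ≤ x ∧ x < f) ∧
      ∀ x ∈ T, ∀ y ∈ T, x + y ≠ f ∧ (x + y < f → x + y ∈ T) := by
  simp [truncations, Finset.subset_iff]

open Classical in
/-- The trace of a submonoid on `[1, f)`. -/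
noncomputable def trunc (f : ℕ) (S : AddSubmonoid ℕ) : Finset ℕ := {x ∈ Finset.Ico 1 f | x ∈ S}

theorem mem_trunc {f : ℕ} {S : AddSubmonoid ℕ} {x : ℕ} :
    x ∈ trunc f S ↔ (1 ≤ x ∧ x < f) ∧ x ∈ S := by
  simp [trunc]

/-- The numerical semigroup with Frobenius number `f` and given trace on `[1, f)`. -/
def ofTruncation (f : ℕ) (T : Finset ℕ) (hT : T ∈ truncations f) : AddSubmonoid ℕ where
  carrier := {x | x = 0 ∨ x ∈ T ∨ f < x}
  zero_mem' := Or.inl rfl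
  add_mem' := by
    intro a b ha hb
    rw [mem_truncations] at hT
    simp only [Set.mem_ofPred_eq] at *
    rcases ha with rfl | ha | ha
    · simpa using hb
    · rcases hb with rfl | hb | hb
      · simp [ha]
      · have := hT.2 a ha b hb
        by_cases h : a + b < f
        · exact Or.inr (Or.inl (this.2 h))
        · right; right; omega
      · right; right; omega
    · right; right; omega

theorem mem_ofTruncation {f : ℕ} {T : Finset ℕ} (hT : T ∈ truncations f) {x : ℕ} :
    x ∈ ofTruncation f T hT ↔ x = 0 ∨ x ∈ T ∨ f < x := Iff.rfl

theorem frobCard_eq_card_truncations {f : ℕ} (hf : 0 < f) :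
    frobCard f = (truncations f).card := by
  rw [frobCard, ← Set.ncard_coe_finset]
  refine Set.ncard_congr (fun S _ => trunc f S) ?_ ?_ ?_
  · rintro S ⟨-, hS, -⟩
    rw [Finset.mem_coe, mem_truncations]
    refine ⟨fun x hx => (mem_trunc.1 hx).1, fun x hx y hy => ⟨?_, fun h => ?_⟩⟩
    · rintro rfl
      exact hS.2 (add_mem (mem_trunc.1 hx).2 (mem_trunc.1 hy).2)
    · rw [mem_trunc] at *
      exact ⟨⟨by omega, h⟩, add_mem hx.2 hy.2⟩
  · rintro S S' ⟨-, hS, hS1⟩ ⟨-, hS', hS1'⟩ h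
    ext x
    rcases Nat.eq_zero_or_pos x with rfl | hx
    · simp
    rcases lt_trichotomy x f with h1 | rfl | h1
    · have := Finset.ext_iff.1 h x
      simpa [mem_trunc, h1, Nat.one_le_iff_ne_zero, hx.ne'] using this
    · exact iff_of_false hS.2 hS'.2
    · refine iff_of_true ?_ ?_
      · by_contra h2
        exact absurd (hS1 ⟨hx, h2⟩) (by omega)
      · by_contra h2
        exact absurd (hS1' ⟨hx, h2⟩) (by omega)
  · intro T hT
    rw [Finset.mem_coe] at hT
    have hT' := mem_truncations.1 hT
    refine ⟨ofTruncation f T hT, ⟨?_, ⟨hf, ?_⟩, ?_⟩, ?_⟩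
    · refine (Set.finite_Iic f).subset fun x hx => ?_
      by_contra h
      exact hx (Or.inr (Or.inr (by simpa using h)))
    · rw [mem_ofTruncation]
      rintro (h | h | h)
      · omega
      · exact absurd (hT'.1 f h) (by omega)
      · omega
    · rintro x ⟨-, hx⟩
      by_contra h
      exact hx (Or.inr (Or.inr (by omega)))
    · ext x
      rw [mem_trunc, mem_ofTruncation]
      constructor
      · rintro ⟨h, h1 | h1 | h1⟩
        · omega
        · exact h1
        · omega
      · intro h
        exact ⟨hT'.1 x h, Or.inr (Or.inl h)⟩

theorem trunc_mem_truncations {n : ℕ} {S : AddSubmonoid ℕ} (hS : S ∈ maxPrimSet n) :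
    trunc n S ∈ truncations n := by
  rw [mem_truncations]
  refine ⟨fun x hx => (mem_trunc.1 hx).1, fun x hx y hy => ⟨?_, fun h => ?_⟩⟩
  · rw [mem_trunc] at *
    intro h
    exact hS.2.1.2 ⟨x, ⟨hx.2, by simp; omega⟩, y, ⟨hy.2, by simp; omega⟩, h⟩
  · rw [mem_trunc] at *
    exact ⟨⟨by omega, h⟩, add_mem hx.2 hy.2⟩

theorem closure_insert_trunc {n : ℕ} {S : AddSubmonoid ℕ} (hS : S ∈ maxPrimSet n) :
    AddSubmonoid.closure (insert n (trunc n S : Set ℕ)) = S := by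
  apply le_antisymm
  · rw [AddSubmonoid.closure_le]
    rintro x (rfl | hx)
    · exact hS.2.1.1.1
    · exact (mem_trunc.1 hx).2
  · conv_lhs => rw [← closure_primitives S]
    refine AddSubmonoid.closure_mono fun x hx => ?_
    have h1 : x ≤ n := hS.2.2 hx
    have h2 : x ≠ 0 := hx.1.2
    rcases h1.eq_or_lt with rfl | h1
    · exact Set.mem_insert _ _
    · exact Set.mem_insert_of_mem _ (mem_trunc.2 ⟨⟨by omega, h1⟩, hx.1.1⟩)

theorem injOn_trunc (n : ℕ) : Set.InjOn (trunc n) (maxPrimSet n) := by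
  intro S hS S' hS' h
  rw [← closure_insert_trunc hS, ← closure_insert_trunc hS', h]

theorem maxPrimCard_le_card_truncations (n : ℕ) : maxPrimCard n ≤ (truncations n).card := by
  rw [maxPrimCard, ← Set.ncard_coe_finset]
  exact Set.ncard_le_ncard_of_injOn (trunc n) (fun S hS => trunc_mem_truncations hS)
    (injOn_trunc n) (Finset.finite_toSet _)

theorem mem_closure_insert_truncation {n : ℕ} {T : Finset ℕ} (hT : T ∈ truncations n) {x : ℕ}
    (hx : x ∈ AddSubmonoid.closure (insert n (T : Set ℕ))) : x = 0 ∨ x ∈ T ∨ n ≤ x := by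
  rw [mem_truncations] at hT
  induction hx using AddSubmonoid.closure_induction with
  | mem x hx =>
    rcases hx with rfl | hx
    · right; right; rfl
    · right; left; exact hx
  | zero => left; rfl
  | add a b _ _ ha hb =>
    rcases ha with rfl | ha | ha
    · simpa using hb
    · rcases hb with rfl | hb | hb
      · simp [ha]
      · have := hT.2 a ha b hb
        by_cases h : a + b < n
        · exact Or.inr (Or.inl (this.2 h))
        · right; right; omega
      · right; right; omega
    · right; right; omega

theorem trunc_closure_insert {n : ℕ} {T : Finset ℕ} (hT : T ∈ truncations n) :
    trunc n (AddSubmonoid.closure (insert n (T : Set ℕ))) = T := by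
  ext x
  rw [mem_trunc]
  constructor
  · rintro ⟨h, hx⟩
    rcases mem_closure_insert_truncation hT hx with h1 | h1 | h1
    · omega
    · exact h1
    · omega
  · intro h
    exact ⟨(mem_truncations.1 hT).1 x h, AddSubmonoid.subset_closure (Or.inr h)⟩

/-- Below n the closure adds only 0 to T, so a decomposition of n would use two elements of T, which
a truncation forbids. The primitives lie in every generating set, hence are at most n. -/
theorem closure_insert_mem_maxPrimSet {n : ℕ} (hn : 0 < n) {T : Finset ℕ} (hT : T ∈ truncations n)
    (hS : IsNumericalSemigroup (AddSubmonoid.closure (insert n (T : Set ℕ)))) :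
    AddSubmonoid.closure (insert n (T : Set ℕ)) ∈ maxPrimSet n := by
  have hT' := mem_truncations.1 hT
  refine ⟨hS, ⟨⟨AddSubmonoid.subset_closure (Set.mem_insert _ _), hn.ne'⟩, ?_⟩, ?_⟩
  · rintro ⟨a, ⟨ha, ha0⟩, b, ⟨hb, hb0⟩, hab⟩
    simp only [Set.mem_singleton_iff] at ha0 hb0 hab
    rcases mem_closure_insert_truncation hT ha with h | h | h
    · omega
    · rcases mem_closure_insert_truncation hT hb with h' | h' | h'
      · omega
      · exact (hT'.2 a h b h').1 hab
      · omega
    · omega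
  · intro x hx
    rcases (isLeast_primitives _).2 rfl hx with rfl | h
    · exact le_rfl
    · exact (hT'.1 x h).2.le

/-- The closure contains all large multiples of the gcd of s, so it is cofinite when the gcd is 1;
the positive element n excludes gcd 0. -/
theorem exists_dvd_of_not_isNumericalSemigroup_closure {s : Set ℕ} {n : ℕ} (hn : 0 < n)
    (hns : n ∈ s) (hs : ¬ IsNumericalSemigroup (AddSubmonoid.closure s)) :
    ∃ d, 2 ≤ d ∧ ∀ x ∈ s, d ∣ x := by
  refine ⟨Nat.setGcd s, ?_, fun x hx => Nat.setGcd_dvd_of_mem hx⟩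
  by_contra h
  have h0 : Nat.setGcd s ≠ 0 := by
    intro h0
    have := Nat.setGcd_dvd_of_mem hns
    rw [h0, zero_dvd_iff] at this
    omega
  have h1 : Nat.setGcd s = 1 := by omega
  obtain ⟨N, hN⟩ := Nat.exists_mem_closure_of_ge s
  refine hs ((Set.finite_Iio N).subset fun x hx => ?_)
  by_contra h2
  exact hx (hN x (by simpa using h2) (by simp [h1]))

/-- The truncations all of whose elements are divisible by `d` are multiples of truncations. -/
theorem card_filter_dvd_truncations_le {n d : ℕ} (hd : 0 < d) (hdn : d ∣ n) :
    ({T ∈ truncations n | ∀ x ∈ T, d ∣ x} : Finset (Finset ℕ)).card ≤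
      (truncations (n / d)).card := by
  obtain ⟨k, rfl⟩ := hdn
  rw [Nat.mul_div_cancel_left _ hd]
  refine Finset.card_le_card_of_surjOn (fun T => T.image (d * ·)) ?_
  intro T hT
  rw [Finset.mem_coe, Finset.mem_filter, mem_truncations] at hT
  obtain ⟨⟨h1, h2⟩, h3⟩ := hT
  have hmem : ∀ x, x ∈ T.image (· / d) ↔ d * x ∈ T := by
    intro x
    rw [Finset.mem_image]
    constructor
    · rintro ⟨y, hy, rfl⟩
      rwa [Nat.mul_div_cancel' (h3 y hy)]
    · intro h
      exact ⟨_, h, Nat.mul_div_cancel_left _ hd⟩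
  refine ⟨T.image (· / d), ?_, ?_⟩
  · rw [Finset.mem_coe, mem_truncations]
    simp only [hmem]
    refine ⟨fun x hx => ?_, fun x hx y hy => ⟨fun h => ?_, fun h => ?_⟩⟩
    · have := h1 _ hx
      exact ⟨Nat.pos_of_mul_pos_left this.1, Nat.lt_of_mul_lt_mul_left this.2⟩
    · exact (h2 _ hx _ hy).1 (by rw [← h]; ring)
    · rw [mul_add]
      refine (h2 _ hx _ hy).2 ?_
      rw [← mul_add]
      exact Nat.mul_lt_mul_of_pos_left h hd
  · simp only
    rw [Finset.image_image]
    conv_rhs => rw [← Finset.image_id (s := T)]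
    exact Finset.image_congr fun x hx => Nat.mul_div_cancel' (h3 x hx)

/-- The truncations T for which T ∪ {n} generates a numerical semigroup inject into the semigroups
with maximum primitive n. The others have all elements divisible by some divisor d ≥ 2 of n. -/
theorem card_truncations_le_maxPrimCard_add {n : ℕ} (hn : 0 < n) :
    (truncations n).card ≤ maxPrimCard n +
      ∑ d ∈ n.divisors.erase 1, (truncations (n / d)).card := by
  classical
  have h1 : ((truncations n).filter
      (fun T : Finset ℕ => IsNumericalSemigroup (AddSubmonoid.closure (insert n (T : Set ℕ))))).card ≤
      maxPrimCard n := by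
    rw [maxPrimCard, ← Set.ncard_coe_finset]
    refine Set.ncard_le_ncard_of_injOn
      (fun T : Finset ℕ => AddSubmonoid.closure (insert n (T : Set ℕ))) ?_ ?_
      (finite_maxPrimSet n)
    · intro T hT
      rw [Finset.mem_coe, Finset.mem_filter] at hT
      exact closure_insert_mem_maxPrimSet hn hT.1 hT.2
    · intro T hT T' hT' h
      rw [Finset.mem_coe, Finset.mem_filter] at hT hT'
      rw [← trunc_closure_insert hT.1, ← trunc_closure_insert hT'.1]
      exact congrArg _ h
  have h2 : ((truncations n).filter
      (fun T : Finset ℕ => ¬ IsNumericalSemigroup (AddSubmonoid.closure (insert n (T : Set ℕ))))).card ≤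
      ∑ d ∈ n.divisors.erase 1, (truncations (n / d)).card := by
    refine (Finset.card_le_card (t := (n.divisors.erase 1).biUnion fun d =>
      {T ∈ truncations n | ∀ x ∈ T, d ∣ x}) ?_).trans (Finset.card_biUnion_le.trans ?_)
    · intro T hT
      rw [Finset.mem_filter] at hT
      obtain ⟨d, hd, hdv⟩ :=
        exists_dvd_of_not_isNumericalSemigroup_closure hn (Set.mem_insert _ _) hT.2
      simp only [Finset.mem_biUnion, Finset.mem_erase, Nat.mem_divisors, Finset.mem_filter]
      exact ⟨d, ⟨by omega, hdv n (Set.mem_insert _ _), hn.ne'⟩, hT.1,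
        fun x hx => hdv x (Set.mem_insert_of_mem _ hx)⟩
    · refine Finset.sum_le_sum fun d hd => ?_
      simp only [Finset.mem_erase, Nat.mem_divisors] at hd
      exact card_filter_dvd_truncations_le (Nat.pos_of_dvd_of_pos hd.2.1 hn) hd.2.1
  have h3 := Finset.card_filter_add_card_filter_not (s := truncations n)
    (fun T : Finset ℕ => IsNumericalSemigroup (AddSubmonoid.closure (insert n (T : Set ℕ))))
  omega

/-- Every set of integers strictly between `f / 2` and `f` is a truncation. -/
theorem two_pow_le_card_truncations (f : ℕ) : 2 ^ ((f - 1) / 2) ≤ (truncations f).card := by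
  have h : (Finset.Ico (f / 2 + 1) f).powerset ⊆ truncations f := by
    intro T hT
    rw [Finset.mem_powerset] at hT
    rw [mem_truncations]
    refine ⟨fun x hx => ?_, fun x hx y hy => ?_⟩
    · have := Finset.mem_Ico.1 (hT hx)
      omega
    · have h1 := Finset.mem_Ico.1 (hT hx)
      have h2 := Finset.mem_Ico.1 (hT hy)
      exact ⟨by omega, by omega⟩
  refine le_trans ?_ (Finset.card_le_card h)
  rw [Finset.card_powerset, Nat.card_Ico]
  exact Nat.pow_le_pow_right two_pos (by omega)

/-! ### Counting families of functions through their restrictions. -/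

section TraceCard

variable {τ α : Type*} (F : Finset τ) (n : τ → ℕ → ℕ)

/-- The number of distinct restrictions to `D` of the functions `n T`, for `T ∈ F`. -/
def traceCard (D : Finset ℕ) : ℕ := (F.image fun T => D.image fun i => (i, n T i)).card

variable {F n}

theorem image_graph_eq_iff {T T' : τ} {D : Finset ℕ} :
    (D.image fun i => (i, n T i)) = (D.image fun i => (i, n T' i)) ↔ ∀ i ∈ D, n T i = n T' i := by
  constructor
  · intro h i hi
    have : (i, n T i) ∈ D.image fun i => (i, n T' i) := h ▸ Finset.mem_image_of_mem _ hi
    obtain ⟨j, -, hj⟩ := Finset.mem_image.1 this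
    simp only [Prod.mk.injEq] at hj
    rw [← hj.2, hj.1]
  · intro h
    exact Finset.image_congr fun i hi => by simp [h i hi]

theorem traceCard_union_le (D D' : Finset ℕ) :
    traceCard F n (D ∪ D') ≤ traceCard F n D * traceCard F n D' := by
  unfold traceCard
  refine le_trans (Finset.card_le_card ?_) (Finset.card_image₂_le (· ∪ ·) _ _)
  intro A hA
  obtain ⟨T, hT, rfl⟩ := Finset.mem_image.1 hA
  simp only [Finset.image_union]
  exact Finset.mem_image₂_of_mem (Finset.mem_image_of_mem _ hT) (Finset.mem_image_of_mem _ hT)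

/-- The invariant φ T determines the restriction to D, so it suffices to count its possible values.
-/
theorem traceCard_le {D : Finset ℕ} (P : Finset α) (φ : τ → α) (hφ : ∀ T ∈ F, φ T ∈ P)
    (h : ∀ T ∈ F, ∀ T' ∈ F, φ T = φ T' → ∀ i ∈ D, n T i = n T' i) : traceCard F n D ≤ P.card := by
  classical
  refine Finset.card_le_card_of_surjOn (fun a => if ha : ∃ T ∈ F, φ T = a then
    D.image (fun i => (i, n ha.choose i)) else ∅) ?_
  intro A hA
  obtain ⟨T, hT, rfl⟩ := Finset.mem_image.1 hA
  have ha : ∃ T' ∈ F, φ T' = φ T := ⟨T, hT, rfl⟩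
  refine ⟨φ T, hφ T hT, ?_⟩
  simp only [dif_pos ha]
  exact image_graph_eq_iff.2 (h _ ha.choose_spec.1 _ hT ha.choose_spec.2)

theorem traceCard_empty_le : traceCard F n ∅ ≤ 1 :=
  traceCard_le {()} (fun _ => ()) (by simp) (by simp)

theorem card_le_traceCard {D : Finset ℕ}
    (h : ∀ T ∈ F, ∀ T' ∈ F, (∀ i ∈ D, n T i = n T' i) → T = T') : F.card ≤ traceCard F n D := by
  unfold traceCard
  rw [Finset.card_image_of_injOn]
  intro T hT T' hT' hTT'
  exact h T hT T' hT' (image_graph_eq_iff.1 hTT')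

theorem traceCard_biUnion_le {ι : Type*} (J : Finset ι) (b : ι → Finset ℕ) :
    traceCard F n (J.biUnion b) ≤ ∏ j ∈ J, traceCard F n (b j) := by
  classical
  induction J using Finset.induction_on with
  | empty => simpa using traceCard_empty_le
  | insert a s ha ih =>
    rw [Finset.biUnion_insert, Finset.prod_insert ha]
    exact (traceCard_union_le _ _).trans (Nat.mul_le_mul_left _ ih)

/-- If `σ` is an involution, bounds for the pairs `{i, σ i}` give a bound for all of `D`. -/
theorem traceCard_le_prod {σ : ℕ → ℕ} {w : ℕ → ℝ} (hw : ∀ i, 0 ≤ w i) (D : Finset ℕ)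
    (hD : ∀ i ∈ D, σ i ∈ D) (hσ : ∀ i ∈ D, σ (σ i) = i)
    (h2 : ∀ i ∈ D, σ i ≠ i → (traceCard F n {i, σ i} : ℝ) ≤ w i * w (σ i))
    (h1 : ∀ i ∈ D, σ i = i → (traceCard F n {i} : ℝ) ≤ w i) :
    (traceCard F n D : ℝ) ≤ ∏ i ∈ D, w i := by
  induction D using Finset.strongInduction with
  | H D ih =>
    rcases D.eq_empty_or_nonempty with rfl | ⟨i, hi⟩
    · simpa using traceCard_empty_le (F := F) (n := n)
    -- A nonempty σ-stable block can be split off, since its complement is σ-stable too; it is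
    -- applied to the orbit of i.
    have key : ∀ B ⊆ D, B.Nonempty → (∀ j ∈ B, σ j ∈ B) →
        (traceCard F n B : ℝ) ≤ ∏ i ∈ B, w i → (traceCard F n D : ℝ) ≤ ∏ i ∈ D, w i := by
      intro B hB hne hσB hle
      have hih := ih (D \ B) (Finset.sdiff_ssubset hB hne) (fun j hj => by
        rw [Finset.mem_sdiff] at hj ⊢
        refine ⟨hD j hj.1, fun hj' => hj.2 ?_⟩
        have := hσB _ hj'
        rwa [hσ j hj.1] at this) (fun j hj => hσ j (Finset.mem_sdiff.1 hj).1)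
        (fun j hj => h2 j (Finset.mem_sdiff.1 hj).1) (fun j hj => h1 j (Finset.mem_sdiff.1 hj).1)
      have hu : traceCard F n D ≤ traceCard F n (D \ B) * traceCard F n B := by
        conv_lhs => rw [← Finset.sdiff_union_of_subset hB]
        exact traceCard_union_le _ _
      rw [← Finset.prod_sdiff hB]
      calc (traceCard F n D : ℝ) ≤ traceCard F n (D \ B) * traceCard F n B := by exact_mod_cast hu
        _ ≤ _ := mul_le_mul hih hle (by positivity) (Finset.prod_nonneg fun j _ => hw j)
    by_cases hii : σ i = i
    · exact key {i} (by simpa using hi) (by simp) (by simp [hii]) (by simpa using h1 i hi hii)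
    · refine key {i, σ i} ?_ (by simp) ?_ ?_
      · intro j hj
        rw [Finset.mem_insert, Finset.mem_singleton] at hj
        rcases hj with rfl | rfl
        · exact hi
        · exact hD i hi
      · intro j hj
        rw [Finset.mem_insert, Finset.mem_singleton] at hj ⊢
        rcases hj with rfl | rfl
        · exact Or.inr rfl
        · exact Or.inl (hσ i hi)
      · rw [Finset.prod_pair (Ne.symm hii)]
        exact h2 i hi hii

/-- A version of `traceCard_le_prod` with a gain of `γ` for each of a family of disjoint blocks. -/
theorem traceCard_le_pow_mul_prod {ι : Type*} {σ : ℕ → ℕ} {w : ℕ → ℝ} {γ : ℝ}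
    (hw : ∀ i, 0 ≤ w i) (D : Finset ℕ)
    (hD : ∀ i ∈ D, σ i ∈ D) (hσ : ∀ i ∈ D, σ (σ i) = i)
    (h2 : ∀ i ∈ D, σ i ≠ i → (traceCard F n {i, σ i} : ℝ) ≤ w i * w (σ i))
    (h1 : ∀ i ∈ D, σ i = i → (traceCard F n {i} : ℝ) ≤ w i)
    (J : Finset ι) (b : ι → Finset ℕ) (hJ : (J : Set ι).PairwiseDisjoint b)
    (hbD : ∀ j ∈ J, b j ⊆ D) (hbσ : ∀ j ∈ J, ∀ i ∈ b j, σ i ∈ b j)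
    (hb : ∀ j ∈ J, (traceCard F n (b j) : ℝ) ≤ γ * ∏ i ∈ b j, w i) :
    (traceCard F n D : ℝ) ≤ γ ^ J.card * ∏ i ∈ D, w i := by
  classical
  obtain ⟨B, hB⟩ : ∃ B, B = J.biUnion b := ⟨_, rfl⟩
  have hBD : B ⊆ D := by rw [hB, Finset.biUnion_subset]; exact hbD
  have hBσ : ∀ i ∈ B, σ i ∈ B := by
    intro i hi
    rw [hB, Finset.mem_biUnion] at hi ⊢
    obtain ⟨j, hj, hij⟩ := hi
    exact ⟨j, hj, hbσ j hj i hij⟩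
  have e1 : (traceCard F n (D \ B) : ℝ) ≤ ∏ i ∈ D \ B, w i := by
    refine traceCard_le_prod (σ := σ) hw _ (fun j hj => ?_)
      (fun j hj => hσ j (Finset.mem_sdiff.1 hj).1)
      (fun j hj => h2 j (Finset.mem_sdiff.1 hj).1) (fun j hj => h1 j (Finset.mem_sdiff.1 hj).1)
    rw [Finset.mem_sdiff] at hj ⊢
    refine ⟨hD j hj.1, fun hj' => hj.2 ?_⟩
    have := hBσ _ hj'
    rwa [hσ j hj.1] at this
  have e2 : (traceCard F n B : ℝ) ≤ γ ^ J.card * ∏ i ∈ B, w i := by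
    have hu : (traceCard F n B : ℝ) ≤ ∏ j ∈ J, (traceCard F n (b j) : ℝ) := by
      rw [hB]
      exact_mod_cast traceCard_biUnion_le J b
    refine hu.trans ((Finset.prod_le_prod (fun _ _ => by positivity) hb).trans ?_)
    rw [Finset.prod_mul_distrib, Finset.prod_const, hB, Finset.prod_biUnion hJ]
  have hu : traceCard F n D ≤ traceCard F n (D \ B) * traceCard F n B := by
    conv_lhs => rw [← Finset.sdiff_union_of_subset hBD]
    exact traceCard_union_le _ _
  rw [← Finset.prod_sdiff hBD]
  calc (traceCard F n D : ℝ) ≤ traceCard F n (D \ B) * traceCard F n B := by exact_mod_cast hu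
    _ ≤ (∏ i ∈ D \ B, w i) * (γ ^ J.card * ∏ i ∈ B, w i) :=
      mul_le_mul e1 e2 (by positivity) (Finset.prod_nonneg fun j _ => hw j)
    _ = _ := by ring

end TraceCard

/-! ### Truncations of multiplicity m and their residue profiles. -/

/-- The truncations with least element `m`. -/
def truncationsMin (f m : ℕ) : Finset (Finset ℕ) :=
  {T ∈ truncations f | m ∈ T ∧ ∀ x ∈ T, m ≤ x}

/-- The residue class of `i` modulo `m` in `[1, f)`. -/
def residueClass (f m i : ℕ) : Finset ℕ := {x ∈ Finset.Ico 1 f | x % m = i}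

/-- The number of elements of `T` congruent to `i` modulo `m`. -/
def profile (m : ℕ) (T : Finset ℕ) (i : ℕ) : ℕ := (T.filter (· % m = i)).card

/-- The residues modulo `m` other than `0` and that of `f`. -/
def freeResidues (f m : ℕ) : Finset ℕ := (Finset.Ico 1 m).erase (f % m)

theorem mem_freeResidues {f m i : ℕ} :
    i ∈ freeResidues f m ↔ i ≠ f % m ∧ 1 ≤ i ∧ i < m := by
  simp [freeResidues]

theorem mem_residueClass {f m i x : ℕ} :
    x ∈ residueClass f m i ↔ (1 ≤ x ∧ x < f) ∧ x % m = i := by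
  simp [residueClass]

section Min

variable {f m : ℕ} {T T' : Finset ℕ}

theorem pos_of_mem_truncationsMin (hT : T ∈ truncationsMin f m) : 0 < m ∧ m < f := by
  simp only [truncationsMin, Finset.mem_filter, mem_truncations] at hT
  exact hT.1.1 m hT.2.1

theorem add_mem_of_mem_truncationsMin (hT : T ∈ truncationsMin f m) {x y : ℕ} (hx : x ∈ T)
    (hy : y ∈ T) (h : x + y < f) : x + y ∈ T := by
  simp only [truncationsMin, Finset.mem_filter, mem_truncations] at hT
  exact (hT.1.2 x hx y hy).2 h

theorem add_ne_of_mem_truncationsMin (hT : T ∈ truncationsMin f m) {x y : ℕ} (hx : x ∈ T)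
    (hy : y ∈ T) : x + y ≠ f := by
  simp only [truncationsMin, Finset.mem_filter, mem_truncations] at hT
  exact (hT.1.2 x hx y hy).1

theorem min_mem (hT : T ∈ truncationsMin f m) : m ∈ T := by
  simp only [truncationsMin, Finset.mem_filter] at hT
  exact hT.2.1

theorem min_le (hT : T ∈ truncationsMin f m) {x : ℕ} (hx : x ∈ T) : m ≤ x := by
  simp only [truncationsMin, Finset.mem_filter] at hT
  exact hT.2.2 x hx

theorem bounds_of_mem (hT : T ∈ truncationsMin f m) {x : ℕ} (hx : x ∈ T) : 1 ≤ x ∧ x < f := by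
  simp only [truncationsMin, Finset.mem_filter, mem_truncations] at hT
  exact hT.1.1 x hx

theorem add_mul_mem (hT : T ∈ truncationsMin f m) {x : ℕ} (hx : x ∈ T) (c : ℕ)
    (h : x + m * c < f) : x + m * c ∈ T := by
  induction c with
  | zero => simpa using hx
  | succ c ih =>
    rw [mul_add, mul_one, ← add_assoc] at h ⊢
    exact add_mem_of_mem_truncationsMin hT (ih (by omega)) (min_mem hT) h

theorem mem_of_le_of_mod_eq (hT : T ∈ truncationsMin f m) {x y : ℕ} (hx : x ∈ T) (hxy : x ≤ y)
    (hy : y < f) (hm : x % m = y % m) : y ∈ T := by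
  obtain ⟨c, hc⟩ := (Nat.modEq_iff_dvd' hxy).1 hm
  have hyx : y = x + m * c := by omega
  rw [hyx] at hy ⊢
  exact add_mul_mem hT hx c hy

theorem mem_of_mod_eq_zero (hT : T ∈ truncationsMin f m) {x : ℕ} (hx : 1 ≤ x) (hxf : x < f)
    (h : x % m = 0) : x ∈ T :=
  mem_of_le_of_mod_eq hT (min_mem hT) (Nat.le_of_dvd hx (Nat.dvd_of_mod_eq_zero h)) hxf
    (by rw [Nat.mod_self, h])

/-- Otherwise f - x would be a positive multiple of m, hence in T, and f would be a sum of two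
elements of T. -/
theorem mod_ne_of_mem (hT : T ∈ truncationsMin f m) {x : ℕ} (hx : x ∈ T) : x % m ≠ f % m := by
  intro h
  have hx' := bounds_of_mem hT hx
  have hd : m ∣ f - x := (Nat.modEq_iff_dvd' hx'.2.le).1 h
  refine add_ne_of_mem_truncationsMin hT hx
    (mem_of_mod_eq_zero hT (x := f - x) (by omega) (by omega) (Nat.mod_eq_zero_of_dvd hd)) (by omega)

theorem filter_subset_residueClass (hT : T ∈ truncationsMin f m) (i : ℕ) :
    T.filter (· % m = i) ⊆ residueClass f m i := by
  intro x hx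
  rw [Finset.mem_filter] at hx
  exact mem_residueClass.2 ⟨bounds_of_mem hT hx.1, hx.2⟩

/-- Adding m stays in T as long as the result is below f, so T meets each class in a final segment,
determined by its size. -/
theorem filter_eq_of_profile_eq (hT : T ∈ truncationsMin f m) (hT' : T' ∈ truncationsMin f m)
    {i : ℕ} (h : profile m T i = profile m T' i) :
    T.filter (· % m = i) = T'.filter (· % m = i) := by
  by_cases hsub : T.filter (· % m = i) ⊆ T'.filter (· % m = i)
  · exact Finset.eq_of_subset_of_card_le hsub h.ge
  by_cases hsub' : T'.filter (· % m = i) ⊆ T.filter (· % m = i)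
  · exact (Finset.eq_of_subset_of_card_le hsub' h.le).symm
  exfalso
  obtain ⟨x, hx, hx'⟩ := Finset.not_subset.1 hsub
  obtain ⟨y, hy, hy'⟩ := Finset.not_subset.1 hsub'
  simp only [Finset.mem_filter, not_and] at *
  rcases le_total x y with hxy | hxy
  · exact hy' (mem_of_le_of_mod_eq hT hx.1 hxy (bounds_of_mem hT' hy.1).2 (by omega)) hy.2
  · exact hx' (mem_of_le_of_mod_eq hT' hy.1 hxy (bounds_of_mem hT hx.1).2 (by omega)) hx.2

theorem subset_of_profile_eq (hT : T ∈ truncationsMin f m) (hT' : T' ∈ truncationsMin f m)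
    (h : ∀ i ∈ freeResidues f m, profile m T i = profile m T' i) : T ⊆ T' := by
  intro x hx
  have hx' := bounds_of_mem hT hx
  by_cases h0 : x % m = 0
  · exact mem_of_mod_eq_zero hT' hx'.1 hx'.2 h0
  have hf := filter_eq_of_profile_eq hT hT' (h (x % m) (mem_freeResidues.2
    ⟨mod_ne_of_mem hT hx, by omega, Nat.mod_lt _ (pos_of_mem_truncationsMin hT).1⟩))
  have : x ∈ T.filter (· % m = x % m) := by simp [hx]
  rw [hf] at this
  exact (Finset.mem_filter.1 this).1

theorem eq_of_profile_eq (hT : T ∈ truncationsMin f m) (hT' : T' ∈ truncationsMin f m)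
    (h : ∀ i ∈ freeResidues f m, profile m T i = profile m T' i) : T = T' :=
  (subset_of_profile_eq hT hT' h).antisymm
    (subset_of_profile_eq hT' hT fun i hi => (h i hi).symm)

theorem sub_mod_eq {i j x : ℕ} (hi : i < m) (hij : (i + j) % m = f % m) (hx : x ≤ f)
    (hxj : x % m = j) : (f - x) % m = i := by
  have h1 : (f - x) + x ≡ i + x [MOD m] := by
    rw [Nat.sub_add_cancel hx]
    refine Nat.ModEq.trans (b := i + j) hij.symm ?_
    refine Nat.ModEq.add_left i ?_
    rw [← hxj]
    exact Nat.mod_modEq x m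
  have h2 := Nat.ModEq.add_right_cancel' x h1
  rw [Nat.ModEq, Nat.mod_eq_of_lt hi] at h2
  exact h2

theorem injOn_sub_left {s : Finset ℕ} (hs : ∀ x ∈ s, x ≤ f) : Set.InjOn (f - ·) (s : Set ℕ) := by
  intro x hx y hy hxy
  have h1 := hs x hx
  have h2 := hs y hy
  simp only at hxy
  omega

theorem card_residueClass_le {i j : ℕ} (hi : i < m) (hij : (i + j) % m = f % m) :
    (residueClass f m j).card ≤ (residueClass f m i).card := by
  refine Finset.card_le_card_of_injOn (f - ·) ?_ (injOn_sub_left fun x hx => ?_)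
  · intro x hx
    have hx := mem_residueClass.1 (Finset.mem_coe.1 hx)
    change f - x ∈ residueClass f m i
    exact mem_residueClass.2 ⟨by omega, sub_mod_eq hi hij (by omega) hx.2⟩
  · exact (mem_residueClass.1 hx).1.2.le

theorem card_residueClass_eq {i j : ℕ} (hi : i < m) (hj : j < m) (hij : (i + j) % m = f % m) :
    (residueClass f m j).card = (residueClass f m i).card :=
  le_antisymm (card_residueClass_le hi hij) (card_residueClass_le hj (by rwa [add_comm]))

/-- The reflection x ↦ f - x carries the elements in class j into class i, where they avoid T
because no two elements of T sum to f. -/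
theorem profile_add_profile_le (hT : T ∈ truncationsMin f m) {i j : ℕ} (hi : i < m)
    (hij : (i + j) % m = f % m) :
    profile m T i + profile m T j ≤ (residueClass f m i).card := by
  have h1 : profile m T j = ((T.filter (· % m = j)).image (f - ·)).card := by
    rw [Finset.card_image_of_injOn, profile]
    exact injOn_sub_left fun x hx => (bounds_of_mem hT (Finset.mem_filter.1 hx).1).2.le
  rw [h1, profile, ← Finset.card_union_of_disjoint]
  · refine Finset.card_le_card (Finset.union_subset (filter_subset_residueClass hT i) ?_)
    intro y hy
    obtain ⟨x, hx, rfl⟩ := Finset.mem_image.1 hy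
    rw [Finset.mem_filter] at hx
    have := bounds_of_mem hT hx.1
    exact mem_residueClass.2 ⟨by omega, sub_mod_eq hi hij (by omega) hx.2⟩
  · rw [Finset.disjoint_left]
    intro y hy hy'
    obtain ⟨x, hx, rfl⟩ := Finset.mem_image.1 hy'
    rw [Finset.mem_filter] at hx hy
    have := bounds_of_mem hT hx.1
    exact add_ne_of_mem_truncationsMin hT hx.1 hy.1 (by omega)

/-- The representative i itself is below the minimum m, hence absent from T. -/
theorem profile_lt (hT : T ∈ truncationsMin f m) {i : ℕ} (hi : 1 ≤ i) (him : i < m) :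
    profile m T i < (residueClass f m i).card := by
  refine Finset.card_lt_card ((Finset.ssubset_iff_of_subset (filter_subset_residueClass hT i)).2
    ⟨i, mem_residueClass.2 ⟨⟨hi, by have := pos_of_mem_truncationsMin hT; omega⟩,
      Nat.mod_eq_of_lt him⟩, fun h => ?_⟩)
  have := min_le hT (Finset.mem_filter.1 h).1
  omega

end Min

/-! ### Counting pairs of profiles, and the resulting weights. -/

/-- The pairs `(a, b)` of numbers smaller than `l` with sum at most `l`. -/
def profilePairs (l : ℕ) : Finset (ℕ × ℕ) :=
  {p ∈ Finset.range l ×ˢ Finset.range l | p.1 + p.2 ≤ l}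

theorem two_mul_card_profilePairs_le {l : ℕ} (hl : 1 ≤ l) :
    2 * (profilePairs l).card + 2 ≤ l ^ 2 + 3 * l := by
  -- For b = 0 the condition a < l is the binding one; for b ≥ 1 it is a ≤ l - b.
  have h1 : profilePairs l ⊆ (Finset.range l).biUnion fun b =>
      (Finset.range (if b = 0 then l else l + 1 - b)).image fun a => (a, b) := by
    rintro ⟨a, b⟩ h
    simp only [profilePairs, Finset.mem_filter, Finset.mem_product, Finset.mem_range] at h
    simp only [Finset.mem_biUnion, Finset.mem_image, Finset.mem_range, Prod.mk.injEq]
    refine ⟨b, h.1.2, a, ?_, rfl, rfl⟩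
    split_ifs <;> omega
  have h2 : (profilePairs l).card ≤ ∑ b ∈ Finset.range l, (if b = 0 then l else l + 1 - b) := by
    refine (Finset.card_le_card h1).trans (Finset.card_biUnion_le.trans ?_)
    refine Finset.sum_le_sum fun b _ => Finset.card_image_le.trans ?_
    rw [Finset.card_range]
  have h3 : ∀ k, k ≤ l → 2 * ∑ b ∈ Finset.range (k + 1), (if b = 0 then l else l + 1 - b)
      + k ^ 2 = 2 * l + 2 * l * k + k := by
    intro k hk
    induction k with
    | zero => simp
    | succ k ih =>
      have := ih (by omega)
      rw [Finset.sum_range_succ, if_neg (by omega)]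
      obtain ⟨c, rfl⟩ := Nat.exists_eq_add_of_le hk
      rw [show k + 1 + c + 1 - (k + 1) = c + 1 by omega]
      nlinarith
  obtain ⟨k, rfl⟩ := Nat.exists_eq_add_of_le' hl
  have := h3 k (by omega)
  nlinarith

section Weights

variable {f m : ℕ} {F : Finset (Finset ℕ)}

theorem traceCard_pair_le (hF : F ⊆ truncationsMin f m) {i j : ℕ} (hi : 1 ≤ i) (him : i < m)
    (hj : 1 ≤ j) (hjm : j < m) (hij : (i + j) % m = f % m) :
    traceCard F (profile m) {i, j} ≤ (profilePairs (residueClass f m i).card).card := by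
  refine traceCard_le _ (fun T => (profile m T i, profile m T j)) ?_ ?_
  · intro T hT
    have h1 := profile_lt (hF hT) hi him
    have h2 := profile_lt (hF hT) hj hjm
    rw [card_residueClass_eq him hjm hij] at h2
    simp [profilePairs, h1, h2, profile_add_profile_le (hF hT) him hij]
  · intro T _ T' _ h k hk
    simp only [Prod.mk.injEq] at h
    rw [Finset.mem_insert, Finset.mem_singleton] at hk
    rcases hk with rfl | rfl
    · exact h.1
    · exact h.2

theorem traceCard_singleton_le (hF : F ⊆ truncationsMin f m) {i : ℕ} (him : i < m)
    (hij : (i + i) % m = f % m) :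
    traceCard F (profile m) {i} ≤ (residueClass f m i).card / 2 + 1 := by
  refine (traceCard_le (Finset.range ((residueClass f m i).card / 2 + 1))
    (fun T => profile m T i) ?_ ?_).trans (Finset.card_range _).le
  · intro T hT
    have := profile_add_profile_le (hF hT) him hij
    rw [Finset.mem_range]
    omega
  · intro T _ T' _ h k hk
    rw [Finset.mem_singleton] at hk
    rw [hk]
    exact h

/-- The residue complementary to `i`. -/
def coResidue (f m i : ℕ) : ℕ := if i ≤ f % m then f % m - i else m + f % m - i

theorem add_coResidue_mod {i : ℕ} (hi : i < m) : (i + coResidue f m i) % m = f % m := by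
  unfold coResidue
  split_ifs with h
  · rw [Nat.add_sub_cancel' h, Nat.mod_mod]
  · rw [Nat.add_sub_cancel' (by omega), Nat.add_mod_left, Nat.mod_mod]

theorem coResidue_mem {i : ℕ} (hi : i ∈ freeResidues f m) :
    coResidue f m i ∈ freeResidues f m := by
  rw [mem_freeResidues] at *
  have := Nat.mod_lt f (show 0 < m by omega)
  unfold coResidue
  split_ifs <;> omega

theorem coResidue_coResidue {i : ℕ} (hi : i ∈ freeResidues f m) :
    coResidue f m (coResidue f m i) = i := by
  rw [mem_freeResidues] at *
  have := Nat.mod_lt f (show 0 < m by omega)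
  unfold coResidue
  split_ifs <;> omega

theorem coResidue_eq_of_add {i j : ℕ} (hi : i ∈ freeResidues f m) (hj : j ∈ freeResidues f m)
    (hij : (i + j) % m = f % m) : coResidue f m i = j := by
  rw [mem_freeResidues] at *
  have := Nat.mod_lt f (show 0 < m by omega)
  have h2 : i + j = f % m ∨ i + j = m + f % m := by
    by_cases h : i + j < m
    · rw [Nat.mod_eq_of_lt h] at hij
      exact Or.inl hij
    · rw [Nat.mod_eq_sub_mod (by omega), Nat.mod_eq_of_lt (by omega)] at hij
      right; omega
  unfold coResidue
  split_ifs <;> omega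

theorem sum_card_residueClass_le (D : Finset ℕ) :
    ∑ i ∈ D, (residueClass f m i).card ≤ f := by
  rw [← Finset.card_biUnion]
  · refine (Finset.card_le_card (t := Finset.range f) ?_).trans (Finset.card_range f).le
    rw [Finset.biUnion_subset]
    intro i _ x hx
    exact Finset.mem_range.2 (mem_residueClass.1 hx).1.2
  · intro i _ j _ hij
    simp only [Finset.disjoint_left]
    intro x hx hx'
    rw [mem_residueClass] at *
    exact hij (hx.2.symm.trans hx'.2)

theorem one_le_card_residueClass (hmf : m < f) {i : ℕ} (hi : i ∈ freeResidues f m) :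
    1 ≤ (residueClass f m i).card := by
  rw [mem_freeResidues] at hi
  exact Finset.card_pos.2 ⟨i, mem_residueClass.2 ⟨by omega, Nat.mod_eq_of_lt hi.2.2⟩⟩

/-- This serves a residue i with 2i ≡ f, which is paired with itself: its profile has at most l/2 +
1 values, so its single weight t^l suffices whenever the pair bound holds for t. -/
theorem half_sq_le {l : ℕ} (hl : 1 ≤ l) :
    (((l / 2 + 1 : ℕ) : ℝ)) ^ 2 ≤ ((l : ℝ) ^ 2 + 3 * l - 2) / 2 := by
  rcases hl.eq_or_lt with rfl | hl
  · norm_num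
  · have h1 : ((l / 2 : ℕ) : ℝ) ≤ l / 2 := Nat.cast_div_le
    have h2 : (2 : ℝ) ≤ l := by exact_mod_cast hl
    have h0 : (0 : ℝ) ≤ ((l / 2 : ℕ) : ℝ) := by positivity
    push_cast
    nlinarith

/-- The bound by the weights `t ^ l`, with a gain of `γ` for each of a family of disjoint blocks. -/
theorem card_le_pow_mul_pow {ι : Type*} (hF : F ⊆ truncationsMin f m) (hmf : m < f) {t γ : ℝ}
    (ht : 1 ≤ t) (hγ : 0 ≤ γ)
    (hlen : ∀ i ∈ freeResidues f m, (((residueClass f m i).card : ℝ) ^ 2 +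
      3 * (residueClass f m i).card - 2) / 2 ≤ (t ^ 2) ^ (residueClass f m i).card)
    (J : Finset ι) (b : ι → Finset ℕ) (hJ : (J : Set ι).PairwiseDisjoint b)
    (hbD : ∀ j ∈ J, b j ⊆ freeResidues f m)
    (hbσ : ∀ j ∈ J, ∀ i ∈ b j, ∃ k ∈ b j, (i + k) % m = f % m)
    (hb : ∀ j ∈ J, (traceCard F (profile m) (b j) : ℝ) ≤
      γ * ∏ i ∈ b j, t ^ (residueClass f m i).card) :
    (F.card : ℝ) ≤ γ ^ J.card * t ^ f := by
  have h1 : F.card ≤ traceCard F (profile m) (freeResidues f m) :=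
    card_le_traceCard fun T hT T' hT' h => eq_of_profile_eq (hF hT) (hF hT') h
  have h2 := traceCard_le_pow_mul_prod (F := F) (n := profile m) (σ := coResidue f m)
    (w := fun i => t ^ (residueClass f m i).card) (γ := γ) (fun i => by positivity)
    (freeResidues f m) (fun i hi => coResidue_mem hi) (fun i hi => coResidue_coResidue hi)
    ?_ ?_ J b hJ hbD ?_ hb
  · refine (Nat.cast_le.2 h1).trans (h2.trans ?_)
    rw [Finset.prod_pow_eq_pow_sum]
    exact mul_le_mul_of_nonneg_left (pow_le_pow_right₀ ht (sum_card_residueClass_le _))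
      (by positivity)
  · intro i hi _
    have hi' := mem_freeResidues.1 hi
    have hj' := mem_freeResidues.1 (coResidue_mem hi)
    have hs := add_coResidue_mod (f := f) hi'.2.2
    have e1 := traceCard_pair_le hF hi'.2.1 hi'.2.2 hj'.2.1 hj'.2.2 hs
    have e2 := two_mul_card_profilePairs_le (one_le_card_residueClass hmf hi)
    rw [card_residueClass_eq hi'.2.2 hj'.2.2 hs, ← pow_add, ← two_mul, pow_mul]
    refine (Nat.cast_le.2 e1).trans (le_trans ?_ (hlen i hi))
    have e3 : (2 * ((profilePairs (residueClass f m i).card).card : ℝ) + 2) ≤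
      ((residueClass f m i).card : ℝ) ^ 2 + 3 * (residueClass f m i).card := by exact_mod_cast e2
    linarith
  · intro i hi hii
    have hi' := mem_freeResidues.1 hi
    have hs := add_coResidue_mod (f := f) hi'.2.2
    rw [hii] at hs
    refine (Nat.cast_le.2 (traceCard_singleton_le hF hi'.2.2 hs)).trans ?_
    refine le_of_sq_le_sq ?_ (by positivity)
    refine (half_sq_le (one_le_card_residueClass hmf hi)).trans ((hlen i hi).trans_eq ?_)
    ring
  · intro j hj i hi
    obtain ⟨k, hk, hik⟩ := hbσ j hj i hi
    rwa [coResidue_eq_of_add (hbD j hj hi) (hbD j hj hk) hik]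

/-- Equality holds at l = 2 and l = 3, so classes of three elements yield no gain by themselves. -/
theorem quadratic_le_two_pow {l : ℕ} (hl : 1 ≤ l) :
    ((l : ℝ) ^ 2 + 3 * l - 2) / 2 ≤ (√2 ^ 2) ^ l := by
  rw [Real.sq_sqrt (by norm_num)]
  by_cases h : l < 3
  · interval_cases l <;> norm_num
  · induction l, (not_lt.1 h) using Nat.le_induction with
    | base => norm_num
    | succ k hk ih =>
      have := ih (by omega) (by omega)
      have hk' : (3 : ℝ) ≤ k := by exact_mod_cast hk
      push_cast
      rw [pow_succ (2 : ℝ) k]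
      nlinarith

/-- The base 19/10 is nearly forced by l = 4, where 13 is compared with 1.9^4 ≈ 13.03. -/
theorem quadratic_le_pow {l : ℕ} (hl : 4 ≤ l) :
    ((l : ℝ) ^ 2 + 3 * l - 2) / 2 ≤ (√(19 / 10) ^ 2) ^ l := by
  rw [Real.sq_sqrt (by norm_num)]
  induction l, hl using Nat.le_induction with
  | base => norm_num
  | succ k hk ih =>
    have hk' : (4 : ℝ) ≤ k := by exact_mod_cast hk
    push_cast
    rw [pow_succ (19 / 10 : ℝ) k]
    nlinarith

/-- The case of the weight `√2`. -/
theorem card_le_pow_mul_sqrt_two_pow {ι : Type*} (hF : F ⊆ truncationsMin f m) (hmf : m < f)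
    {γ : ℝ} (hγ : 0 ≤ γ)
    (J : Finset ι) (b : ι → Finset ℕ) (hJ : (J : Set ι).PairwiseDisjoint b)
    (hbD : ∀ j ∈ J, b j ⊆ freeResidues f m)
    (hbσ : ∀ j ∈ J, ∀ i ∈ b j, ∃ k ∈ b j, (i + k) % m = f % m)
    (hb : ∀ j ∈ J, (traceCard F (profile m) (b j) : ℝ) ≤
      γ * √2 ^ (∑ i ∈ b j, (residueClass f m i).card)) :
    (F.card : ℝ) ≤ γ ^ J.card * √2 ^ f := by
  refine card_le_pow_mul_pow hF hmf (by rw [Real.one_le_sqrt]; norm_num) hγ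
    (fun i hi => quadratic_le_two_pow (one_le_card_residueClass hmf hi)) J b hJ hbD hbσ ?_
  simpa only [Finset.prod_pow_eq_pow_sum] using hb

theorem residueClass_eq_image {i q : ℕ} (hi : 1 ≤ i) (him : i < m) (h1 : m * q + i < f)
    (h2 : f ≤ m * (q + 1) + i) :
    residueClass f m i = (Finset.range (q + 1)).image (m * · + i) := by
  ext x
  simp only [mem_residueClass, Finset.mem_image, Finset.mem_range]
  constructor
  · rintro ⟨hx, rfl⟩
    refine ⟨x / m, ?_, Nat.div_add_mod x m⟩
    by_contra h
    have := Nat.mul_le_mul_left m (not_lt.1 h)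
    have := Nat.div_add_mod x m
    omega
  · rintro ⟨j, hj, rfl⟩
    have := Nat.mul_le_mul_left m (Nat.le_of_lt_succ hj)
    exact ⟨by omega, by rw [Nat.mul_add_mod, Nat.mod_eq_of_lt him]⟩

theorem card_image_range_mul_add {i q : ℕ} (hm : 0 < m) :
    ((Finset.range q).image (m * · + i)).card = q := by
  rw [Finset.card_image_of_injective, Finset.card_range]
  intro a b h
  simp only [add_left_inj] at h
  exact Nat.eq_of_mul_eq_mul_left hm h

theorem card_residueClass_of_bounds {i q : ℕ} (hi : 1 ≤ i) (him : i < m) (h1 : m * q + i < f)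
    (h2 : f ≤ m * (q + 1) + i) : (residueClass f m i).card = q + 1 := by
  rw [residueClass_eq_image hi him h1 h2, card_image_range_mul_add (by omega)]

theorem le_card_residueClass {i q : ℕ} (hi : 1 ≤ i) (him : i < m) (h1 : m * q + i < f) :
    q + 1 ≤ (residueClass f m i).card := by
  rw [← card_image_range_mul_add (m := m) (i := i) (q := q + 1) (by omega)]
  refine Finset.card_le_card fun x hx => ?_
  simp only [Finset.mem_image, Finset.mem_range] at hx
  obtain ⟨j, hj, rfl⟩ := hx
  have := Nat.mul_le_mul_left m (Nat.le_of_lt_succ hj)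
  exact mem_residueClass.2 ⟨by omega, by rw [Nat.mul_add_mod, Nat.mod_eq_of_lt him]⟩

/-! ### Gains from classes with four or more elements. -/

/-- Depth at least four. -/
theorem card_truncationsMin_le_of_four_mul_le (h : 4 * m ≤ f) :
    ((truncationsMin f m).card : ℝ) ≤ (19 / 20) ^ (f / 2) * √2 ^ f := by
  rcases (truncationsMin f m).eq_empty_or_nonempty with h0 | ⟨T, hT⟩
  · rw [h0, Finset.card_empty, Nat.cast_zero]
    positivity
  have hm := pos_of_mem_truncationsMin hT
  have h1 := card_le_pow_mul_pow (F := truncationsMin f m) (ι := ℕ) (t := √(19 / 10)) (γ := 1)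
    subset_rfl hm.2 (by rw [Real.one_le_sqrt]; norm_num) zero_le_one (fun i hi => by
      rw [mem_freeResidues] at hi
      exact quadratic_le_pow (le_card_residueClass (q := 3) hi.2.1 hi.2.2 (by omega)))
    ∅ (fun _ => ∅) (by simp) (by simp) (by simp) (by simp)
  rw [one_pow, one_mul] at h1
  refine h1.trans ?_
  have h2 : √(19 / 10) = √(19 / 20) * √2 := by
    rw [← Real.sqrt_mul (by norm_num)]; norm_num
  rw [h2, mul_pow]
  refine mul_le_mul_of_nonneg_right ?_ (by positivity)
  calc √(19 / 20) ^ f ≤ √(19 / 20) ^ (2 * (f / 2)) :=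
        pow_le_pow_of_le_one (by positivity) (by rw [Real.sqrt_le_iff]; norm_num)
          (by omega)
    _ = _ := by rw [pow_mul, Real.sq_sqrt (by norm_num)]

/-- Depth four, away from the boundary with depth three. -/
theorem card_truncationsMin_le_of_lt_four_mul {r : ℕ} (hf : f = 3 * m + r) (hr : r < m) :
    ((truncationsMin f m).card : ℝ) ≤ (13 / 16) ^ ((r - 1) / 2) * √2 ^ f := by
  have hmod : f % m = r := by
    rw [hf, mul_comm, Nat.mul_add_mod, Nat.mod_eq_of_lt hr]
  have hlen : ∀ i, 1 ≤ i → i < r → (residueClass f m i).card = 4 := fun i hi hir =>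
    card_residueClass_of_bounds (q := 3) hi (by omega) (by omega) (by omega)
  -- The residues below r have four-element classes and are paired by i ↦ r - i; each pair admits 13
  -- profiles against a weight of 2^4.
  have h1 := card_le_pow_mul_sqrt_two_pow (F := truncationsMin f m) (γ := 13 / 16)
    subset_rfl (by omega) (by norm_num) (Finset.range ((r - 1) / 2))
    (fun j => {j + 1, r - (j + 1)}) ?_ ?_ ?_ ?_
  · rwa [Finset.card_range] at h1
  · intro j hj j' hj' hne
    simp only [Finset.coe_range, Set.mem_Iio] at hj hj'
    simp only [Function.onFun, Finset.disjoint_left, Finset.mem_insert, Finset.mem_singleton]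
    omega
  · intro j hj i hi
    rw [Finset.mem_range] at hj
    rw [Finset.mem_insert, Finset.mem_singleton] at hi
    rw [mem_freeResidues, hmod]
    omega
  · intro j hj i hi
    rw [Finset.mem_range] at hj
    rw [Finset.mem_insert, Finset.mem_singleton] at hi
    refine ⟨r - i, ?_, ?_⟩
    · rw [Finset.mem_insert, Finset.mem_singleton]
      omega
    · rw [show i + (r - i) = r by omega, hmod, Nat.mod_eq_of_lt hr]
  · intro j hj
    rw [Finset.mem_range] at hj
    rw [Finset.sum_pair (by omega), hlen _ (by omega) (by omega), hlen _ (by omega) (by omega)]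
    have h2 := traceCard_pair_le (F := truncationsMin f m) subset_rfl (i := j + 1)
      (j := r - (j + 1)) (by omega) (by omega) (by omega) (by omega)
      (by rw [show j + 1 + (r - (j + 1)) = r by omega, hmod, Nat.mod_eq_of_lt hr])
    rw [hlen _ (by omega) (by omega)] at h2
    have h3 : (profilePairs 4).card = 13 := by decide
    rw [h3] at h2
    have h4 : √2 ^ (4 + 4) = 16 := by
      rw [show 4 + 4 = 2 * 4 by norm_num, pow_mul, Real.sq_sqrt (by norm_num)]; norm_num
    rw [h4]
    have : (traceCard (truncationsMin f m) (profile m) {j + 1, r - (j + 1)} : ℝ) ≤ 13 := by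
      exact_mod_cast h2
    linarith

end Weights

/-! ### Gains from classes with three elements. -/

section Region

variable {f m s c : ℕ}

/-- The residues strictly between `s` and `c - s` are paired by `i ↦ c - i`, and their classes have
three elements. -/
structure IsTripleRegion (f m s c : ℕ) : Prop where
  mod_eq : c % m = f % m
  mem : ∀ i, s < i → i + s < c → i ∈ freeResidues f m
  lt : ∀ i, s < i → i + s < c → m * 2 + i < f
  le : ∀ i, s < i → i + s < c → f ≤ m * 3 + i

theorem IsTripleRegion.card_eq (h : IsTripleRegion f m s c) {i : ℕ} (h1 : s < i)
    (h2 : i + s < c) : (residueClass f m i).card = 3 := by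
  have := mem_freeResidues.1 (h.mem i h1 h2)
  exact card_residueClass_of_bounds (q := 2) this.2.1 this.2.2 (h.lt i h1 h2) (h.le i h1 h2)

theorem IsTripleRegion.residueClass_eq (h : IsTripleRegion f m s c) {i : ℕ} (h1 : s < i)
    (h2 : i + s < c) : residueClass f m i = {i, m + i, 2 * m + i} := by
  have := mem_freeResidues.1 (h.mem i h1 h2)
  rw [residueClass_eq_image (q := 2) this.2.1 this.2.2 (h.lt i h1 h2) (h.le i h1 h2)]
  ext x
  simp only [Finset.mem_image, Finset.mem_range, Finset.mem_insert, Finset.mem_singleton]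
  constructor
  · rintro ⟨j, hj, rfl⟩
    interval_cases j <;> omega
  · rintro (rfl | rfl | rfl)
    · exact ⟨0, by omega, by omega⟩
    · exact ⟨1, by omega, by omega⟩
    · exact ⟨2, by omega, by omega⟩

theorem IsTripleRegion.profile_le_one (h : IsTripleRegion f m s c) {T : Finset ℕ}
    (hT : T ∈ truncationsMin f m) {i : ℕ} (h1 : s < i) (h2 : i + s < c) (hi : m + i ∉ T) :
    profile m T i ≤ 1 := by
  have hi' := mem_freeResidues.1 (h.mem i h1 h2)
  have hsub : T.filter (· % m = i) ⊆ {2 * m + i} := by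
    intro x hx
    have hx' := filter_subset_residueClass hT i hx
    rw [h.residueClass_eq h1 h2] at hx'
    simp only [Finset.mem_insert, Finset.mem_singleton] at hx'
    rcases hx' with rfl | rfl | rfl
    · have := min_le hT (Finset.mem_filter.1 hx).1
      omega
    · exact absurd (Finset.mem_filter.1 hx).1 hi
    · exact Finset.mem_singleton_self _
  exact (Finset.card_le_card hsub).trans (Finset.card_singleton _).le

theorem IsTripleRegion.one_le_profile (h : IsTripleRegion f m s c) {T : Finset ℕ}
    {i : ℕ} (h1 : s < i) (h2 : i + s < c) (hi : 2 * m + i ∈ T) : 1 ≤ profile m T i := by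
  have hi' := mem_freeResidues.1 (h.mem i h1 h2)
  exact Finset.card_pos.2 ⟨_, Finset.mem_filter.2 ⟨hi, by
    rw [mul_comm, Nat.mul_add_mod, Nat.mod_eq_of_lt hi'.2.2]⟩⟩

/-- The truncations without elements in `(m, m + R)`. -/
theorem IsTripleRegion.card_filter_notMem_le (h : IsTripleRegion f m s c) (hmf : m < f) {n R : ℕ}
    (hn : 2 * (s + n) < c) (hR : s + n < R) :
    ({T ∈ truncationsMin f m | ∀ i ∈ Finset.Ioo 0 R, m + i ∉ T} : Finset _).card ≤
      ((3 : ℝ) / 4) ^ n * √2 ^ f := by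
  obtain ⟨F, hF⟩ : ∃ F, F = ({T ∈ truncationsMin f m | ∀ i ∈ Finset.Ioo 0 R, m + i ∉ T} :
    Finset _) := ⟨_, rfl⟩
  rw [← hF]
  have hFs : F ⊆ truncationsMin f m := hF ▸ Finset.filter_subset _ _
  have h1 := card_le_pow_mul_sqrt_two_pow (F := F) (γ := 3 / 4) hFs hmf
    (by norm_num) (Finset.range n) (fun j => {s + 1 + j, c - (s + 1 + j)}) ?_ ?_ ?_ ?_
  · rwa [Finset.card_range] at h1
  · intro j hj j' hj' hne
    simp only [Finset.coe_range, Set.mem_Iio] at hj hj'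
    simp only [Function.onFun, Finset.disjoint_left, Finset.mem_insert, Finset.mem_singleton]
    omega
  · intro j hj i hi
    rw [Finset.mem_range] at hj
    rw [Finset.mem_insert, Finset.mem_singleton] at hi
    exact h.mem i (by omega) (by omega)
  · intro j hj i hi
    rw [Finset.mem_range] at hj
    rw [Finset.mem_insert, Finset.mem_singleton] at hi
    refine ⟨c - i, ?_, ?_⟩
    · rw [Finset.mem_insert, Finset.mem_singleton]
      omega
    · rw [show i + (c - i) = c by omega, h.mod_eq]
  · intro j hj
    rw [Finset.mem_range] at hj
    obtain ⟨i, hi⟩ : ∃ i, i = s + 1 + j := ⟨_, rfl⟩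
    rw [← hi, Finset.sum_pair (by omega), h.card_eq (by omega) (by omega),
      h.card_eq (by omega) (by omega)]
    have hi' := mem_freeResidues.1 (h.mem i (by omega) (by omega))
    have hc' := mem_freeResidues.1 (h.mem (c - i) (by omega) (by omega))
    -- Without m + i the profile at i is 0 or 1, which leaves at most 6 pairs against the weight 8.
    have h2 : traceCard F (profile m) {i, c - i} ≤
        (Finset.range 2 ×ˢ Finset.range 3).card := by
      refine traceCard_le _ (fun T => (profile m T i, profile m T (c - i))) ?_ ?_
      · intro T hT
        have hT' := hT
        rw [hF, Finset.mem_filter] at hT'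
        have e1 := h.profile_le_one hT'.1 (i := i) (by omega) (by omega)
          (hT'.2 i (Finset.mem_Ioo.2 ⟨by omega, by omega⟩))
        have e2 := profile_lt hT'.1 hc'.2.1 hc'.2.2
        rw [h.card_eq (by omega) (by omega)] at e2
        simp only [Finset.mem_product, Finset.mem_range]
        omega
      · intro T _ T' _ hTT' k hk
        simp only [Prod.mk.injEq] at hTT'
        rw [Finset.mem_insert, Finset.mem_singleton] at hk
        rcases hk with rfl | rfl
        · exact hTT'.1
        · exact hTT'.2
    have h3 : (traceCard F (profile m) {i, c - i} : ℝ) ≤ 6 := by exact_mod_cast h2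
    have h4 : √2 ^ (3 + 3) = 8 := by
      rw [show 3 + 3 = 2 * 3 by norm_num, pow_mul, Real.sq_sqrt (by norm_num)]; norm_num
    rw [h4]
    linarith

/-- The possible profiles at `i`, `c - i`, `i + d` and `c - (i + d)` when `m + d ∈ T`. -/
def profileQuadruples : Finset ((ℕ × ℕ) × ℕ × ℕ) :=
  {p ∈ profilePairs 3 ×ˢ profilePairs 3 | p.1.1 = 2 → 1 ≤ p.2.1}

theorem card_profileQuadruples : profileQuadruples.card = 58 := by decide

theorem mem_profilePairs {l a b : ℕ} : (a, b) ∈ profilePairs l ↔ (a < l ∧ b < l) ∧ a + b ≤ l := by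
  simp [profilePairs]

theorem IsTripleRegion.mem_profilePairs (h : IsTripleRegion f m s c) {T : Finset ℕ}
    (hT : T ∈ truncationsMin f m) {i : ℕ} (h1 : s < i) (h2 : i + s < c) :
    (profile m T i, profile m T (c - i)) ∈ profilePairs 3 := by
  have hi := mem_freeResidues.1 (h.mem i h1 h2)
  have hc := mem_freeResidues.1 (h.mem (c - i) (by omega) (by omega))
  have e1 := profile_lt hT hi.2.1 hi.2.2
  have e2 := profile_lt hT hc.2.1 hc.2.2
  have e3 := profile_add_profile_le hT hi.2.2 (j := c - i)
    (by rw [show i + (c - i) = c by omega, h.mod_eq])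
  rw [h.card_eq (by omega) (by omega)] at e1 e2 e3
  exact _root_.mem_profilePairs.2 ⟨⟨e1, e2⟩, e3⟩

/-- Profile 2 at i forces m + i ∈ T, so 2m + i + d ∈ T and the profile at i + d is positive. Of the
64 combinations of two admissible pairs, this excludes the 2 · 3 with profiles 2 at i and 0 at i +
d. -/
theorem IsTripleRegion.traceCard_quadruple_le (h : IsTripleRegion f m s c) {F : Finset (Finset ℕ)}
    {i d : ℕ} (hF : F ⊆ truncationsMin f m) (hd : ∀ T ∈ F, m + d ∈ T)
    (h1 : s < i) (h2 : i + d + s < c) :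
    traceCard F (profile m) {i, c - i, i + d, c - (i + d)} ≤ 58 := by
  rw [← card_profileQuadruples]
  refine traceCard_le _ (fun T => ((profile m T i, profile m T (c - i)),
    (profile m T (i + d), profile m T (c - (i + d))))) ?_ ?_
  · intro T hT
    simp only [profileQuadruples, Finset.mem_filter, Finset.mem_product]
    refine ⟨⟨h.mem_profilePairs (hF hT) h1 (by omega),
      h.mem_profilePairs (hF hT) (by omega) (by omega)⟩, fun hp => ?_⟩
    have him : m + i ∈ T := by
      by_contra hi
      have := h.profile_le_one (hF hT) h1 (by omega) hi
      omega
    refine h.one_le_profile (by omega) (by omega) ?_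
    have := add_mem_of_mem_truncationsMin (hF hT) him (hd T hT)
      (by have := h.lt (i + d) (by omega) (by omega); omega)
    convert this using 1
    ring
  · intro T _ T' _ hTT' k hk
    simp only [Prod.mk.injEq] at hTT'
    simp only [Finset.mem_insert, Finset.mem_singleton] at hk
    rcases hk with rfl | rfl | rfl | rfl
    · exact hTT'.1.1
    · exact hTT'.1.2
    · exact hTT'.2.1
    · exact hTT'.2.2

/-- Restricting j to alternate intervals of length d makes the pairs {j, j + d} disjoint, at the
cost of at most half of the indices. -/
theorem le_two_mul_card_filter_even (N d : ℕ) :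
    N ≤ 2 * ({j ∈ Finset.range N | j / d % 2 = 0} : Finset ℕ).card := by
  rcases Nat.eq_zero_or_pos d with rfl | hd
  · simp; omega
  have h1 : ({j ∈ Finset.range N | ¬ j / d % 2 = 0} : Finset ℕ).card ≤
      ({j ∈ Finset.range N | j / d % 2 = 0} : Finset ℕ).card := by
    have hdj : ∀ j, ¬ j / d % 2 = 0 → d ≤ j := by
      intro j hj
      by_contra hjd
      rw [Nat.div_eq_of_lt (by omega)] at hj
      omega
    refine Finset.card_le_card_of_injOn (· - d) ?_ ?_
    · intro j hj
      have hj' := Finset.mem_filter.1 (Finset.mem_coe.1 hj)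
      rw [Finset.mem_range] at hj'
      have := hdj j hj'.2
      have e : j / d = (j - d) / d + 1 := Nat.div_eq_sub_div hd this
      have e' : j - d ∈ ({j ∈ Finset.range N | j / d % 2 = 0} : Finset ℕ) :=
        Finset.mem_filter.2 ⟨Finset.mem_range.2 (by omega), by omega⟩
      exact e'
    · intro j hj j' hj' hjj'
      have e1 := hdj j (Finset.mem_filter.1 (Finset.mem_coe.1 hj)).2
      have e2 := hdj j' (Finset.mem_filter.1 (Finset.mem_coe.1 hj')).2
      simp only at hjj'
      omega
  have h2 := Finset.card_filter_add_card_filter_not (s := Finset.range N) (fun j => j / d % 2 = 0)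
  rw [Finset.card_range] at h2
  omega

/-- The truncations that contain `m + d`. -/
theorem IsTripleRegion.card_filter_mem_le (h : IsTripleRegion f m s c) (hmf : m < f) {N d n : ℕ}
    (hN : 2 * (s + N) < c) (hd : 0 < d) (hn : 2 * n + d ≤ N) :
    ({T ∈ truncationsMin f m | m + d ∈ T} : Finset _).card ≤ ((29 : ℝ) / 32) ^ n * √2 ^ f := by
  obtain ⟨F, hF⟩ : ∃ F, F = ({T ∈ truncationsMin f m | m + d ∈ T} : Finset _) := ⟨_, rfl⟩
  rw [← hF]
  have hFs : F ⊆ truncationsMin f m := hF ▸ Finset.filter_subset _ _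
  have hFd : ∀ T ∈ F, m + d ∈ T := by
    intro T hT
    rw [hF, Finset.mem_filter] at hT
    exact hT.2
  obtain ⟨J, hJ⟩ : ∃ J, J = ({j ∈ Finset.range (N - d) | j / d % 2 = 0} : Finset ℕ) := ⟨_, rfl⟩
  have hJc : n ≤ J.card := by
    have := le_two_mul_card_filter_even (N - d) d
    rw [hJ]
    omega
  have hJm : ∀ j ∈ J, j < N - d ∧ j / d % 2 = 0 := by
    intro j hj
    rw [hJ, Finset.mem_filter, Finset.mem_range] at hj
    exact hj
  have h1 := card_le_pow_mul_sqrt_two_pow (F := F) (γ := 29 / 32) hFs hmf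
    (by norm_num) J (fun j => {s + 1 + j, c - (s + 1 + j), s + 1 + j + d, c - (s + 1 + j + d)})
    ?_ ?_ ?_ ?_
  · refine h1.trans (mul_le_mul_of_nonneg_right ?_ (by positivity))
    exact pow_le_pow_of_le_one (by norm_num) (by norm_num) hJc
  · intro j hj j' hj' hne
    obtain ⟨hj1, hj2⟩ := hJm j hj
    obtain ⟨hj1', hj2'⟩ := hJm j' hj'
    have e1 : (j + d) / d = j / d + 1 := Nat.add_div_right j hd
    have e2 : (j' + d) / d = j' / d + 1 := Nat.add_div_right j' hd
    have e3 : j ≠ j' + d := by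
      rintro rfl
      omega
    have e4 : j' ≠ j + d := by
      rintro rfl
      omega
    simp only [Function.onFun, Finset.disjoint_left, Finset.mem_insert, Finset.mem_singleton]
    omega
  · intro j hj i hi
    obtain ⟨hj1, hj2⟩ := hJm j hj
    simp only [Finset.mem_insert, Finset.mem_singleton] at hi
    exact h.mem i (by omega) (by omega)
  · intro j hj i hi
    obtain ⟨hj1, hj2⟩ := hJm j hj
    simp only [Finset.mem_insert, Finset.mem_singleton] at hi
    refine ⟨c - i, ?_, ?_⟩
    · simp only [Finset.mem_insert, Finset.mem_singleton]
      omega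
    · rw [show i + (c - i) = c by omega, h.mod_eq]
  · intro j hj
    obtain ⟨hj1, hj2⟩ := hJm j hj
    obtain ⟨i, hi⟩ : ∃ i, i = s + 1 + j := ⟨_, rfl⟩
    rw [← hi, Finset.sum_insert (by simp; omega), Finset.sum_insert (by simp; omega),
      Finset.sum_pair (by omega), h.card_eq (by omega) (by omega),
      h.card_eq (by omega) (by omega), h.card_eq (by omega) (by omega),
      h.card_eq (by omega) (by omega)]
    have h3 : (traceCard F (profile m) {i, c - i, i + d, c - (i + d)} : ℝ) ≤ 58 := by
      exact_mod_cast h.traceCard_quadruple_le hFs hFd (by omega) (by omega)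
    have h4 : √2 ^ (3 + (3 + (3 + 3))) = 64 := by
      rw [show 3 + (3 + (3 + 3)) = 2 * 6 by norm_num, pow_mul, Real.sq_sqrt (by norm_num)]
      norm_num
    rw [h4]
    linarith

/-- Either T has no element just above m, and each pair of residues near the edge of the region
gains 3/4, or it contains some m + d with d small, and each quadruple with shift d gains 29/32. The
factor N + 1 pays for the choice of d. -/
theorem IsTripleRegion.card_truncationsMin_le (h : IsTripleRegion f m s c) (hmf : m < f) {N : ℕ}
    (hN : 2 * (s + N) < c) (hs : 4 * s ≤ N) :
    (truncationsMin f m).card ≤ ((N + 1 : ℕ) : ℝ) * (29 / 32) ^ (N / 8) * √2 ^ f := by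
  -- This cutoff leaves N / 2 pairs in the first case; in the second d ≤ s + N / 2 ≤ 3N / 4, which
  -- leaves room for N / 8 quadruples.
  obtain ⟨R, hR⟩ : ∃ R, R = s + 1 + N / 2 := ⟨_, rfl⟩
  have h1 : truncationsMin f m ⊆
      {T ∈ truncationsMin f m | ∀ i ∈ Finset.Ioo 0 R, m + i ∉ T} ∪
        (Finset.Ico 1 R).biUnion fun d => {T ∈ truncationsMin f m | m + d ∈ T} := by
    intro T hT
    by_cases hT' : ∀ i ∈ Finset.Ioo 0 R, m + i ∉ T
    · exact Finset.mem_union_left _ (Finset.mem_filter.2 ⟨hT, hT'⟩)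
    · push Not at hT'
      obtain ⟨d, hd, hdT⟩ := hT'
      rw [Finset.mem_Ioo] at hd
      refine Finset.mem_union_right _ (Finset.mem_biUnion.2 ⟨d, ?_, ?_⟩)
      · exact Finset.mem_Ico.2 hd
      · exact Finset.mem_filter.2 ⟨hT, hdT⟩
  have h2 := (Finset.card_le_card h1).trans ((Finset.card_union_le _ _).trans
    (Nat.add_le_add_left Finset.card_biUnion_le _))
  have e1 : (({T ∈ truncationsMin f m | ∀ i ∈ Finset.Ioo 0 R, m + i ∉ T} : Finset _).card : ℝ) ≤
      (29 / 32) ^ (N / 8) * √2 ^ f := by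
    refine (h.card_filter_notMem_le hmf (n := N / 2) (by omega) (by omega)).trans
      (mul_le_mul_of_nonneg_right ?_ (by positivity))
    calc ((3 : ℝ) / 4) ^ (N / 2) ≤ (3 / 4) ^ (N / 8) :=
          pow_le_pow_of_le_one (by norm_num) (by norm_num) (by omega)
      _ ≤ _ := pow_le_pow_left₀ (by norm_num) (by norm_num) _
  have e2 : ((∑ d ∈ Finset.Ico 1 R, ({T ∈ truncationsMin f m | m + d ∈ T} : Finset _).card : ℕ) : ℝ)
      ≤ (R - 1 : ℕ) * ((29 / 32) ^ (N / 8) * √2 ^ f) := by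
    push_cast
    rw [← Nat.card_Ico 1 R, ← nsmul_eq_mul]
    refine Finset.sum_le_card_nsmul _ _ _ fun d hd => ?_
    rw [Finset.mem_Ico] at hd
    exact h.card_filter_mem_le hmf hN (by omega) (by omega)
  have h3 := (Nat.cast_le (α := ℝ)).2 h2
  rw [Nat.cast_add] at h3
  have e3 : ((R - 1 : ℕ) : ℝ) + 1 ≤ ((N + 1 : ℕ) : ℝ) := by
    have : R - 1 + 1 ≤ N + 1 := by omega
    exact_mod_cast this
  have e4 : (0 : ℝ) ≤ (29 / 32) ^ (N / 8) * √2 ^ f := by positivity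
  calc ((truncationsMin f m).card : ℝ)
      ≤ (29 / 32) ^ (N / 8) * √2 ^ f + (R - 1 : ℕ) * ((29 / 32) ^ (N / 8) * √2 ^ f) := by linarith
    _ = (((R - 1 : ℕ) : ℝ) + 1) * ((29 / 32) ^ (N / 8) * √2 ^ f) := by ring
    _ ≤ ((N + 1 : ℕ) : ℝ) * ((29 / 32) ^ (N / 8) * √2 ^ f) := mul_le_mul_of_nonneg_right e3 e4
    _ = _ := by ring

theorem isTripleRegion_zero (h1 : 2 * m < f) (h2 : f ≤ 3 * m) :
    IsTripleRegion f m 0 (f - 2 * m) where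
  mod_eq := by
    conv_rhs => rw [show f = m * 2 + (f - 2 * m) by omega, Nat.mul_add_mod]
  mem i hi hic := by
    rw [mem_freeResidues]
    refine ⟨fun hif => ?_, by omega, by omega⟩
    rw [show f = m * 2 + (f - 2 * m) by omega, Nat.mul_add_mod] at hif
    rcases h2.eq_or_lt with h2 | h2
    · rw [show f - 2 * m = m by omega, Nat.mod_self] at hif
      omega
    · rw [Nat.mod_eq_of_lt (by omega)] at hif
      omega
  lt i hi hic := by omega
  le i hi hic := by omega

theorem isTripleRegion_of_lt {r : ℕ} (hf : f = 3 * m + r) (hr : r < m) :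
    IsTripleRegion f m r (m + r) where
  mod_eq := by
    rw [hf, mul_comm 3, Nat.mul_add_mod, Nat.add_mod_left]
  mem i hi hic := by
    rw [mem_freeResidues, hf, mul_comm 3, Nat.mul_add_mod, Nat.mod_eq_of_lt hr]
    omega
  lt i hi hic := by omega
  le i hi hic := by omega

end Region

/-! ### The uniform estimate for a given multiplicity. -/

theorem pow_le_nineteen_twentieths_pow {a : ℝ} {k n : ℕ} (ha : 0 ≤ a) (ha' : a ≤ 19 / 20)
    (h : n ≤ k) : a ^ k ≤ (19 / 20) ^ n :=
  (pow_le_pow_left₀ ha ha' k).trans (pow_le_pow_of_le_one (by norm_num) (by norm_num) h)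

/-- The main estimate: small multiplicities contribute little. -/
theorem card_truncationsMin_le {f m : ℕ} (h : 2 * m < f) :
    (truncationsMin f m).card ≤
      ((f - 2 * m + 1 : ℕ) : ℝ) * (19 / 20) ^ ((f - 2 * m) / 100) * √2 ^ f := by
  obtain ⟨q, hq⟩ : ∃ q, q = f - 2 * m := ⟨_, rfl⟩
  rw [← hq]
  have key : ∀ {a b : ℝ}, a ≤ ((q + 1 : ℕ) : ℝ) → 0 ≤ b → b ≤ (19 / 20) ^ (q / 100) →
      ((truncationsMin f m).card : ℝ) ≤ a * b * √2 ^ f →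
      ((truncationsMin f m).card : ℝ) ≤ ((q + 1 : ℕ) : ℝ) * (19 / 20) ^ (q / 100) * √2 ^ f := by
    intro a b ha hb0 hb hab
    exact hab.trans (mul_le_mul_of_nonneg_right (mul_le_mul ha hb hb0 (by positivity))
      (by positivity))
  have h1q : (1 : ℝ) ≤ ((q + 1 : ℕ) : ℝ) := by
    have : 1 ≤ q + 1 := by omega
    exact_mod_cast this
  by_cases h4 : 4 * m ≤ f
  · refine key h1q (by positivity) (pow_le_nineteen_twentieths_pow (a := 19 / 20) (k := f / 2)
      (by norm_num) le_rfl (by omega)) ?_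
    rw [one_mul]
    exact card_truncationsMin_le_of_four_mul_le h4
  by_cases h3 : f ≤ 3 * m
  · refine key (a := (((q - 1) / 2 + 1 : ℕ) : ℝ)) ?_ (by positivity)
      (pow_le_nineteen_twentieths_pow (a := 29 / 32) (k := (q - 1) / 2 / 8)
      (by norm_num) (by norm_num) (by omega))
      ((isTripleRegion_zero h h3).card_truncationsMin_le (by omega) (by omega) (by omega))
    exact_mod_cast (by omega)
  obtain ⟨r, hr⟩ : ∃ r, r = f - 3 * m := ⟨_, rfl⟩
  -- For f = 3m + r with r small relative to m the three-element classes supply the gain. Otherwise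
  -- r is comparable to m, hence to q = m + r, and the four-element classes do.
  by_cases hrm : 4 * r ≤ (m - r - 1) / 2
  · refine key (a := (((m - r - 1) / 2 + 1 : ℕ) : ℝ)) ?_ (by positivity)
      (pow_le_nineteen_twentieths_pow (a := 29 / 32) (k := (m - r - 1) / 2 / 8)
      (by norm_num) (by norm_num) (by omega))
      ((isTripleRegion_of_lt (r := r) (by omega) (by omega)).card_truncationsMin_le (by omega)
        (by omega) hrm)
    exact_mod_cast (by omega)
  · refine key h1q (by positivity) (pow_le_nineteen_twentieths_pow (a := 13 / 16)
      (k := (r - 1) / 2) (by norm_num) (by norm_num) (by omega)) ?_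
    rw [one_mul]
    exact card_truncationsMin_le_of_lt_four_mul (by omega) (by omega)

/-! ### Exact doubling for truncations with elements not far below f / 2. -/

/-- The truncations all of whose elements are at least `h - k`. -/
def truncationsAbove (f h k : ℕ) : Finset (Finset ℕ) := {T ∈ truncations f | ∀ x ∈ T, h ≤ x + k}

theorem mem_truncationsAbove {f h k : ℕ} {T : Finset ℕ} :
    T ∈ truncationsAbove f h k ↔ T ∈ truncations f ∧ ∀ x ∈ T, h ≤ x + k := by
  simp [truncationsAbove]

/-- Shift the elements below `p` by one and the others by two. -/
def spread (p x : ℕ) : ℕ := if x < p then x + 1 else x + 2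

theorem spread_injective (p : ℕ) : Function.Injective (spread p) := by
  intro x y h
  unfold spread at h
  split_ifs at h <;> omega

theorem spread_ne (p x : ℕ) : spread p x ≠ p + 1 := by
  unfold spread
  split_ifs <;> omega

theorem exists_spread_eq {p y : ℕ} (hy : 1 ≤ y) (hyp : y ≠ p + 1) : ∃ x, spread p x = y := by
  unfold spread
  by_cases h : y ≤ p
  · exact ⟨y - 1, by rw [if_pos (by omega)]; omega⟩
  · exact ⟨y - 2, by rw [if_neg (by omega)]; omega⟩

/-- The set of the `x` whose spread lies in `T`. -/
def unspread (p f : ℕ) (T : Finset ℕ) : Finset ℕ := {x ∈ Finset.Ico 1 f | spread p x ∈ T}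

/-- Membership in `truncationsAbove` is preserved and reflected by spreading the elements and adding
or not the new point `p + 1`. -/
theorem mem_truncationsAbove_iff_of_spread {f h k p : ℕ} (hf : 2 * h ≤ f) (hf' : f ≤ 2 * h + 1)
    (hp : h + k + 1 < p) (hp' : p + 2 * k ≤ 2 * h) {T T' : Finset ℕ}
    (hT : ∀ x ∈ T, 1 ≤ x ∧ x < f) (hT' : ∀ x ∈ T', 2 ≤ x ∧ x < f + 2)
    (hTT' : ∀ x, x ∈ T ↔ spread p x ∈ T') :
    T ∈ truncationsAbove f h k ↔ T' ∈ truncationsAbove (f + 2) (h + 1) k := by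
  simp only [mem_truncationsAbove, mem_truncations]
  constructor
  · rintro ⟨⟨-, h2⟩, h3⟩
    have h3' : ∀ x ∈ T', h + 1 ≤ x + k := by
      intro y hy
      by_cases hyp : y = p + 1
      · omega
      obtain ⟨x, rfl⟩ := exists_spread_eq (by have := hT' y hy; omega) hyp
      have := h3 x ((hTT' x).2 hy)
      unfold spread
      split_ifs <;> omega
    refine ⟨⟨fun x hx => ⟨by have := hT' x hx; omega, (hT' x hx).2⟩, fun x hx y hy => ?_⟩, h3'⟩
    -- Only such sums are constrained. Both summands are then at most p, so they come from shifts by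
    -- one, while the sum lies high enough to come from a shift by two.
    by_cases hxy : x + y ≤ f + 2
    · have hx1 := h3' x hx
      have hy1 := h3' y hy
      have hx2 := hT' x hx
      have hy2 := hT' y hy
      have ex : spread p (x - 1) = x := by unfold spread; rw [if_pos (by omega)]; omega
      have ey : spread p (y - 1) = y := by unfold spread; rw [if_pos (by omega)]; omega
      have := h2 (x - 1) ((hTT' _).2 (by rwa [ex])) (y - 1) ((hTT' _).2 (by rwa [ey]))
      refine ⟨by omega, fun hlt => ?_⟩
      have h4 := (hTT' _).1 (this.2 (by omega))
      unfold spread at h4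
      rw [if_neg (by omega)] at h4
      convert h4 using 1
      omega
    · exact ⟨by omega, by omega⟩
  · rintro ⟨⟨-, h2⟩, h3⟩
    have h3' : ∀ x ∈ T, h ≤ x + k := by
      intro x hx
      have := h3 _ ((hTT' x).1 hx)
      unfold spread at this
      split_ifs at this <;> omega
    refine ⟨⟨hT, fun x hx y hy => ?_⟩, h3'⟩
    by_cases hxy : x + y ≤ f
    · have hx1 := h3' x hx
      have hy1 := h3' y hy
      have ex : spread p x = x + 1 := by unfold spread; rw [if_pos (by omega)]
      have ey : spread p y = y + 1 := by unfold spread; rw [if_pos (by omega)]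
      have hx2 := (hTT' x).1 hx
      have hy2 := (hTT' y).1 hy
      rw [ex] at hx2
      rw [ey] at hy2
      have := h2 _ hx2 _ hy2
      refine ⟨by omega, fun hlt => (hTT' _).2 ?_⟩
      unfold spread
      rw [if_neg (by omega)]
      convert this.2 (by omega) using 1
      omega
    · exact ⟨by omega, by omega⟩

/-- All elements being at least h - k, the summands of a sum not exceeding f are at most h + k + 1,
and every sum is at least 2h - 2k. The assumption on h leaves a gap between the two ranges; a point
inserted there takes part in no relation and may be present or absent freely. -/
theorem card_truncationsAbove_add_two {f h k : ℕ} (hf : 2 * h ≤ f) (hf' : f ≤ 2 * h + 1)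
    (hh : 3 * k + 2 ≤ h) :
    (truncationsAbove (f + 2) (h + 1) k).card = 2 * (truncationsAbove f h k).card := by
  obtain ⟨p, hp⟩ : ∃ p, p = h + k + 2 := ⟨_, rfl⟩
  have hlow : ∀ T ∈ truncationsAbove (f + 2) (h + 1) k, ∀ x ∈ T, 2 ≤ x ∧ x < f + 2 := by
    intro T hT x hx
    rw [mem_truncationsAbove, mem_truncations] at hT
    have h1 := hT.1.1 x hx
    have h2 := hT.2 x hx
    omega
  have hsp : ∀ x, 1 ≤ x ∧ x < f → 2 ≤ spread p x ∧ spread p x < f + 2 := by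
    intro x hx
    unfold spread
    split_ifs <;> omega
  have hun : ∀ x, 2 ≤ spread p x ∧ spread p x < f + 2 → 1 ≤ x ∧ x < f := by
    intro x hx
    unfold spread at hx
    split_ifs at hx <;> omega
  have hf2 : ∀ T ∈ truncationsAbove f h k, ∀ x ∈ T, 1 ≤ x ∧ x < f := fun T hT x hx =>
    (mem_truncations.1 (mem_truncationsAbove.1 hT).1).1 x hx
  have e1 : (truncationsAbove (f + 2) (h + 1) k |>.filter (p + 1 ∈ ·)).card =
      (truncationsAbove f h k).card := by
    symm
    refine Finset.card_bij (fun T _ => insert (p + 1) (T.image (spread p))) ?_ ?_ ?_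
    · intro T hT
      rw [Finset.mem_filter]
      refine ⟨(mem_truncationsAbove_iff_of_spread hf hf' (p := p) (by omega) (by omega)
        (hf2 T hT) ?_ ?_).1 hT, Finset.mem_insert_self _ _⟩
      · intro x hx
        rw [Finset.mem_insert, Finset.mem_image] at hx
        rcases hx with rfl | ⟨y, hy, rfl⟩
        · omega
        · exact hsp y (hf2 T hT y hy)
      · intro x
        simp [spread_ne, (spread_injective p).eq_iff]
    · intro T _ T' _ hTT'
      ext x
      have := Finset.ext_iff.1 hTT' (spread p x)
      simpa [spread_ne, (spread_injective p).eq_iff] using this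
    · intro T' hT'
      rw [Finset.mem_filter] at hT'
      have hm : ∀ x, x ∈ unspread p f T' ↔ spread p x ∈ T' := by
        intro x
        simp only [unspread, Finset.mem_filter, Finset.mem_Ico, and_iff_right_iff_imp]
        exact fun hx => hun x (hlow T' hT'.1 _ hx)
      refine ⟨unspread p f T', (mem_truncationsAbove_iff_of_spread hf hf' (p := p) (by omega)
        (by omega) (fun x hx => by simpa using (Finset.mem_filter.1 hx).1) (hlow T' hT'.1) hm).2
        hT'.1, ?_⟩
      ext y
      rw [Finset.mem_insert, Finset.mem_image]
      constructor
      · rintro (rfl | ⟨x, hx, rfl⟩)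
        · exact hT'.2
        · exact (hm x).1 hx
      · intro hy
        by_cases hyp : y = p + 1
        · exact Or.inl hyp
        · obtain ⟨x, rfl⟩ := exists_spread_eq (by have := hlow T' hT'.1 y hy; omega) hyp
          exact Or.inr ⟨x, (hm x).2 hy, rfl⟩
  have e2 : (truncationsAbove (f + 2) (h + 1) k |>.filter (p + 1 ∉ ·)).card =
      (truncationsAbove f h k).card := by
    symm
    refine Finset.card_bij (fun T _ => T.image (spread p)) ?_ ?_ ?_
    · intro T hT
      rw [Finset.mem_filter]
      refine ⟨(mem_truncationsAbove_iff_of_spread hf hf' (p := p) (by omega) (by omega)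
        (hf2 T hT) ?_ ?_).1 hT, ?_⟩
      · intro x hx
        rw [Finset.mem_image] at hx
        rcases hx with ⟨y, hy, rfl⟩
        exact hsp y (hf2 T hT y hy)
      · intro x
        simp [(spread_injective p).eq_iff]
      · simp [spread_ne]
    · intro T _ T' _ hTT'
      exact Finset.image_injective (spread_injective p) hTT'
    · intro T' hT'
      rw [Finset.mem_filter] at hT'
      have hm : ∀ x, x ∈ unspread p f T' ↔ spread p x ∈ T' := by
        intro x
        simp only [unspread, Finset.mem_filter, Finset.mem_Ico, and_iff_right_iff_imp]
        exact fun hx => hun x (hlow T' hT'.1 _ hx)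
      refine ⟨unspread p f T', (mem_truncationsAbove_iff_of_spread hf hf' (p := p) (by omega)
        (by omega) (fun x hx => by simpa using (Finset.mem_filter.1 hx).1) (hlow T' hT'.1) hm).2
        hT'.1, ?_⟩
      ext y
      rw [Finset.mem_image]
      constructor
      · rintro ⟨x, hx, rfl⟩
        exact (hm x).1 hx
      · intro hy
        have hyp : y ≠ p + 1 := fun h => hT'.2 (h ▸ hy)
        obtain ⟨x, rfl⟩ := exists_spread_eq (by have := hlow T' hT'.1 y hy; omega) hyp
        exact ⟨x, (hm x).2 hy, rfl⟩
  have := Finset.card_filter_add_card_filter_not (s := truncationsAbove (f + 2) (h + 1) k)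
    (p + 1 ∈ ·)
  omega

/-! ### Convergence of the normalised number of truncations. -/

/-- The summable bound for the contribution of the multiplicity `(f - q) / 2`. -/
noncomputable def multiplicityWeight (q : ℕ) : ℝ := ((q + 1 : ℕ) : ℝ) * (19 / 20) ^ (q / 100)

theorem multiplicityWeight_nonneg (q : ℕ) : 0 ≤ multiplicityWeight q := by
  unfold multiplicityWeight
  positivity

theorem summable_multiplicityWeight : Summable multiplicityWeight := by
  obtain ⟨ρ, hρ⟩ : ∃ ρ : ℝ, ρ = (19 / 20 : ℝ) ^ (1 / 100 : ℝ) := ⟨_, rfl⟩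
  have hρ0 : 0 < ρ := by rw [hρ]; positivity
  have hρ1 : ρ < 1 := by rw [hρ]; exact Real.rpow_lt_one (by norm_num) (by norm_num) (by norm_num)
  have hρ100 : ρ ^ 100 = 19 / 20 := by
    rw [hρ, ← Real.rpow_natCast, ← Real.rpow_mul (by norm_num)]
    norm_num
  have h1 : Summable fun q : ℕ => (20 / 19 : ℝ) * ((q : ℝ) ^ 1 * ρ ^ q + ρ ^ q) :=
    ((summable_pow_mul_geometric_of_norm_lt_one 1 (by
      rwa [Real.norm_of_nonneg hρ0.le])).add
      (summable_geometric_of_lt_one hρ0.le hρ1)).mul_left _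
  refine Summable.of_nonneg_of_le multiplicityWeight_nonneg (fun q => ?_) h1
  -- The factor 20/19 absorbs the rounding in q / 100, since ρ^(q % 100) ≥ ρ^100 = 19/20.
  have h2 : (19 / 20 : ℝ) ^ (q / 100) ≤ 20 / 19 * ρ ^ q := by
    have e : ρ ^ q = (19 / 20) ^ (q / 100) * ρ ^ (q % 100) := by
      conv_lhs => rw [← Nat.div_add_mod q 100, pow_add, pow_mul, hρ100]
    have e2 : 19 / 20 ≤ ρ ^ (q % 100) := by
      rw [← hρ100]
      exact pow_le_pow_of_le_one hρ0.le hρ1.le (Nat.mod_lt _ (by norm_num)).le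
    have e3 : (0 : ℝ) < (19 / 20) ^ (q / 100) := by positivity
    rw [e]
    nlinarith
  unfold multiplicityWeight
  push_cast
  calc ((q : ℝ) + 1) * (19 / 20) ^ (q / 100) ≤ ((q : ℝ) + 1) * (20 / 19 * ρ ^ q) :=
        mul_le_mul_of_nonneg_left h2 (by positivity)
    _ = _ := by ring

/-- The remaining truncations have minimum m < h - k. The values f - 2m are distinct and at least k,
so their weights add up to at most the tail of the series from k on. -/
theorem card_truncations_le_add {f h k : ℕ} (hf : 2 * h ≤ f) :
    ((truncations f).card : ℝ) ≤
      (truncationsAbove f h k).card + (∑' j, multiplicityWeight (j + k)) * √2 ^ f := by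
  have h1 : truncations f ⊆ truncationsAbove f h k ∪
      (Finset.range (h - k)).biUnion (truncationsMin f) := by
    intro T hT
    by_cases hT' : ∀ x ∈ T, h ≤ x + k
    · exact Finset.mem_union_left _ (mem_truncationsAbove.2 ⟨hT, hT'⟩)
    · push Not at hT'
      obtain ⟨x, hx, hxk⟩ := hT'
      have hne : T.Nonempty := ⟨x, hx⟩
      have hle := T.min'_le x hx
      refine Finset.mem_union_right _ (Finset.mem_biUnion.2 ⟨T.min' hne, ?_, ?_⟩)
      · rw [Finset.mem_range]
        omega
      · exact Finset.mem_filter.2 ⟨hT, T.min'_mem hne, fun y hy => T.min'_le y hy⟩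
  have h2 := (Finset.card_le_card h1).trans ((Finset.card_union_le _ _).trans
    (Nat.add_le_add_left Finset.card_biUnion_le _))
  have h3 := (Nat.cast_le (α := ℝ)).2 h2
  push_cast at h3
  refine h3.trans (add_le_add le_rfl ?_)
  have h4 : ∑ m ∈ Finset.range (h - k), multiplicityWeight (f - 2 * m) ≤
      ∑' j, multiplicityWeight (j + k) := by
    have e : ∑ m ∈ Finset.range (h - k), multiplicityWeight (f - 2 * m) =
        ∑ j ∈ (Finset.range (h - k)).image (fun m => f - 2 * m - k),
          multiplicityWeight (j + k) := by
      rw [Finset.sum_image]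
      · refine Finset.sum_congr rfl fun m hm => ?_
        rw [Finset.mem_range] at hm
        congr 1
        omega
      · intro a ha b hb hab
        simp only [Finset.coe_range, Set.mem_Iio] at ha hb hab
        omega
    rw [e]
    exact ((summable_nat_add_iff k).2 summable_multiplicityWeight).sum_le_tsum _
      fun j _ => multiplicityWeight_nonneg _
  refine le_trans ?_ (mul_le_mul_of_nonneg_right h4 (by positivity))
  rw [Finset.sum_mul]
  refine Finset.sum_le_sum fun m hm => ?_
  rw [Finset.mem_range] at hm
  exact card_truncationsMin_le (by omega)

theorem card_truncationsAbove_le (f h k : ℕ) :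
    (truncationsAbove f h k).card ≤ (truncations f).card :=
  Finset.card_le_card (Finset.filter_subset _ _)

theorem sqrt_two_pow_le (f : ℕ) : √2 ^ f ≤ 2 * ((truncations f).card : ℝ) := by
  have h1 : √2 ^ f ≤ √2 ^ (2 * ((f - 1) / 2 + 1)) :=
    pow_le_pow_right₀ (by rw [Real.one_le_sqrt]; norm_num) (by omega)
  rw [pow_mul, Real.sq_sqrt (by norm_num), pow_succ] at h1
  have h2 : ((2 : ℝ) ^ ((f - 1) / 2)) ≤ (truncations f).card := by
    exact_mod_cast two_pow_le_card_truncations f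
  linarith

/-- Backelin's theorem: along each parity class, the number of numerical semigroups with Frobenius
number `f` is asymptotic to a constant times `2 ^ (f / 2)`. -/
theorem exists_tendsto_card_truncations {e : ℕ} (he : e ≤ 1) : ∃ c : ℝ, 0 < c ∧
    Tendsto (fun h : ℕ => ((truncations (2 * h + e)).card : ℝ) / √2 ^ (2 * h + e)) atTop (𝓝 c) := by
  obtain ⟨u, hu⟩ : ∃ u : ℕ → ℝ,
    u = fun h => ((truncations (2 * h + e)).card : ℝ) / √2 ^ (2 * h + e) := ⟨_, rfl⟩
  have hconst : ∀ k h, 3 * k + 2 ≤ h →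
      ((truncationsAbove (2 * h + e) h k).card : ℝ) / √2 ^ (2 * h + e) =
      (truncationsAbove (2 * (3 * k + 2) + e) (3 * k + 2) k).card / √2 ^ (2 * (3 * k + 2) + e) := by
    intro k h hh
    induction h, hh using Nat.le_induction with
    | base => rfl
    | succ h hh ih =>
      rw [← ih, show 2 * (h + 1) + e = 2 * h + e + 2 by ring,
        card_truncationsAbove_add_two (by omega) (by omega) hh, pow_add,
        Real.sq_sqrt (by norm_num)]
      push_cast
      field_simp
  have hbd : ∀ k h, 3 * k + 2 ≤ h →
      (truncationsAbove (2 * (3 * k + 2) + e) (3 * k + 2) k).card /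
        √2 ^ (2 * (3 * k + 2) + e) ≤ u h ∧ u h ≤
      (truncationsAbove (2 * (3 * k + 2) + e) (3 * k + 2) k).card /
        √2 ^ (2 * (3 * k + 2) + e) + ∑' j, multiplicityWeight (j + k) := by
    intro k h hh
    rw [← hconst k h hh, hu]
    constructor
    · exact div_le_div_of_nonneg_right (Nat.cast_le.2 (card_truncationsAbove_le _ _ _))
        (by positivity)
    · rw [div_add' _ _ _ (by positivity)]
      exact div_le_div_of_nonneg_right (card_truncations_le_add (by omega)) (by positivity)
  -- For h ≥ 3k + 2 all values of u lie in one interval whose length is the tail of the series at k.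
  have hcauchy : CauchySeq u := by
    rw [Metric.cauchySeq_iff']
    intro ε hε
    obtain ⟨k, hk⟩ := ((tendsto_sum_nat_add multiplicityWeight).eventually_lt_const hε).exists
    refine ⟨3 * k + 2, fun h hh => ?_⟩
    have h1 := hbd k h hh
    have h2 := hbd k (3 * k + 2) le_rfl
    rw [Real.dist_eq, abs_lt]
    constructor <;> linarith
  obtain ⟨c, hc⟩ := cauchySeq_tendsto_of_complete hcauchy
  refine ⟨c, ?_, hu ▸ hc⟩
  have : (1 : ℝ) / 2 ≤ c := by
    refine ge_of_tendsto' hc fun h => ?_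
    rw [hu, le_div_iff₀ (by positivity)]
    have := sqrt_two_pow_le (2 * h + e)
    linarith
  linarith

theorem exists_card_truncations_le : ∃ C : ℝ, ∀ f, ((truncations f).card : ℝ) ≤ C * √2 ^ f := by
  obtain ⟨c₀, -, h₀⟩ := exists_tendsto_card_truncations (e := 0) (by norm_num)
  obtain ⟨c₁, -, h₁⟩ := exists_tendsto_card_truncations (e := 1) le_rfl
  obtain ⟨C₀, hC₀⟩ := h₀.bddAbove_range
  obtain ⟨C₁, hC₁⟩ := h₁.bddAbove_range
  refine ⟨max C₀ C₁, fun f => ?_⟩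
  rw [← div_le_iff₀ (by positivity)]
  rcases Nat.even_or_odd' f with ⟨h, rfl | rfl⟩
  · exact (hC₀ ⟨h, rfl⟩).trans (le_max_left _ _)
  · exact (hC₁ ⟨h, rfl⟩).trans (le_max_right _ _)

/-! ### Comparison of the two counts, and the limits. -/

theorem tendsto_maxPrimCard_div_card_truncations :
    Tendsto (fun n : ℕ => (maxPrimCard n : ℝ) / ((truncations n).card : ℝ)) atTop (𝓝 1) := by
  obtain ⟨C, hC⟩ := exists_card_truncations_le
  have hC0 : 0 ≤ C := by
    have := (Nat.cast_nonneg _).trans (hC 0)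
    simpa using this
  have hpos : ∀ n, (0 : ℝ) < (truncations n).card := fun n => by
    have := sqrt_two_pow_le n
    have : (0 : ℝ) < √2 ^ n := by positivity
    linarith
  -- Here β = 2^(-1/4) is the ratio of the growth rate 2^(1/4) of the terms with d ≥ 2 to the main
  -- rate 2^(1/2).
  obtain ⟨β, hβ⟩ : ∃ β : ℝ, β = √(1 / √2) := ⟨_, rfl⟩
  have hβ0 : 0 ≤ β := by rw [hβ]; positivity
  have hs1 : 1 < √2 := by rw [Real.lt_sqrt (by norm_num)]; norm_num
  have hβ1 : β < 1 := by
    rw [hβ, Real.sqrt_lt' one_pos, one_pow, div_lt_one (by positivity)]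
    exact hs1
  have hβ2 : β ^ 2 * √2 = 1 := by
    rw [hβ, Real.sq_sqrt (by positivity)]
    field_simp
  have hlow : ∀ n : ℕ, 0 < n → 1 - 2 * C * (n * β ^ n) ≤
      (maxPrimCard n : ℝ) / ((truncations n).card : ℝ) := by
    intro n hn
    have h1 : ((truncations n).card : ℝ) ≤ maxPrimCard n +
        ∑ d ∈ n.divisors.erase 1, ((truncations (n / d)).card : ℝ) := by
      exact_mod_cast card_truncations_le_maxPrimCard_add hn
    have h2 : ∑ d ∈ n.divisors.erase 1, ((truncations (n / d)).card : ℝ) ≤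
        n * (C * √2 ^ (n / 2)) := by
      refine (Finset.sum_le_card_nsmul _ _ (C * √2 ^ (n / 2)) fun d hd => ?_).trans ?_
      · simp only [Finset.mem_erase, Nat.mem_divisors] at hd
        have hd2 : 2 ≤ d := by
          have := Nat.pos_of_dvd_of_pos hd.2.1 hn
          omega
        exact (hC _).trans (mul_le_mul_of_nonneg_left
          (pow_le_pow_right₀ hs1.le (Nat.div_le_div_left hd2 two_pos)) hC0)
      · rw [nsmul_eq_mul]
        refine mul_le_mul_of_nonneg_right (Nat.cast_le.2 ?_) (by positivity)
        exact (Finset.card_erase_le).trans (Nat.card_divisors_le_self n)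
    have h3 : √2 ^ (n / 2) ≤ β ^ n * √2 ^ n := by
      have e1 : β ^ (2 * (n - n / 2)) ≤ β ^ n := pow_le_pow_of_le_one hβ0 hβ1.le (by omega)
      have e2 : β ^ (2 * (n - n / 2)) * √2 ^ n = √2 ^ (n / 2) := by
        conv_lhs => rw [pow_mul, show n = (n - n / 2) + n / 2 by omega, pow_add √2]
        rw [← mul_assoc, show n - n / 2 + n / 2 - (n - n / 2 + n / 2) / 2 = n - n / 2 by omega,
          ← mul_pow, hβ2, one_pow, one_mul]
      rw [← e2]
      exact mul_le_mul_of_nonneg_right e1 (by positivity)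
    have h4 : β ^ n * √2 ^ n ≤ β ^ n * (2 * (truncations n).card) :=
      mul_le_mul_of_nonneg_left (sqrt_two_pow_le n) (by positivity)
    have h5 : (n : ℝ) * (C * √2 ^ (n / 2)) ≤ n * (C * (β ^ n * (2 * (truncations n).card))) := by
      have := h3.trans h4
      gcongr
    rw [le_div_iff₀ (hpos n)]
    linarith
  have hlim : Tendsto (fun n : ℕ => 1 - 2 * C * ((n : ℝ) * β ^ n)) atTop (𝓝 1) := by
    simpa using ((tendsto_self_mul_const_pow_of_lt_one hβ0 hβ1).const_mul (2 * C)).const_sub 1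
  refine tendsto_of_tendsto_of_tendsto_of_le_of_le' hlim tendsto_const_nhds
    ((eventually_gt_atTop 0).mono fun n hn => hlow n hn) (Eventually.of_forall fun n => ?_)
  rw [div_le_one (hpos n)]
  exact_mod_cast maxPrimCard_le_card_truncations n

theorem exists_tendsto_maxPrimCard {e : ℕ} (he : e ≤ 1) : ∃ c : ℝ, 0 < c ∧
    Tendsto (fun n : ℕ => (maxPrimCard (2 * n + e) : ℝ) / (2 : ℝ) ^ (((2 * n + e : ℕ) : ℝ) / 2))
      atTop (𝓝 c) := by
  obtain ⟨c, hc, h⟩ := exists_tendsto_card_truncations he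
  refine ⟨c, hc, ?_⟩
  have hsub : Tendsto (fun n : ℕ => 2 * n + e) atTop atTop :=
    tendsto_atTop_mono (fun n => by simp only [id]; omega) tendsto_id
  have := (tendsto_maxPrimCard_div_card_truncations.comp hsub).mul h
  rw [one_mul] at this
  refine this.congr fun n => ?_
  have hpos : (0 : ℝ) < (truncations (2 * n + e)).card := by
    have := sqrt_two_pow_le (2 * n + e)
    have : (0 : ℝ) < √2 ^ (2 * n + e) := by positivity
    linarith
  have hpow : (2 : ℝ) ^ (((2 * n + e : ℕ) : ℝ) / 2) = √2 ^ (2 * n + e) := by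
    rw [Real.sqrt_eq_rpow, ← Real.rpow_natCast, ← Real.rpow_mul (by norm_num)]
    congr 1
    ring
  rw [hpow, Function.comp_apply]
  field_simp

theorem mainTheorem7 :
    Tendsto (fun n : ℕ => (maxPrimCard n : ℝ) / (frobCard n : ℝ)) atTop (𝓝 1) ∧
    (∃ c₀ : ℝ, 0 < c₀ ∧
      Tendsto (fun n : ℕ => (maxPrimCard (2 * n) : ℝ) / (2 : ℝ) ^ (((2 * n : ℕ) : ℝ) / 2))
        atTop (𝓝 c₀)) ∧
    (∃ c₁ : ℝ, 0 < c₁ ∧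
      Tendsto (fun n : ℕ => (maxPrimCard (2 * n + 1) : ℝ) / (2 : ℝ) ^ (((2 * n + 1 : ℕ) : ℝ) / 2))
        atTop (𝓝 c₁)) := by
  refine ⟨tendsto_maxPrimCard_div_card_truncations.congr' ?_,
    exists_tendsto_maxPrimCard (e := 0) (by norm_num), exists_tendsto_maxPrimCard le_rfl⟩
  filter_upwards [eventually_gt_atTop 0] with n hn
  rw [frobCard_eq_card_truncations hn]
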